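/- For a group $\Gamma$, the Jordan constant $J(\Gamma)$ is the minimal integer such that every finite subgroup of $\Gamma$ has a normal abelian subgroup of index at most $J(\Gamma)$. Let $K$ be a field of characteristic $0$. Then $J(\mathrm{PGL}_2(K))$ exists and takes one of the values $60, 6, 2$. More explicitly: (i) $J(\mathrm{PGL}_2(K))=60$ if and only if $-1$ is a sum of two squares in $K$ and $5$ is a square in $K$; (ii) $J(\mathrm{PGL}_2(K))=6$ if and only if $-1$ is a sum of two squares in $K$ and $5$ is not a square in $K$; (iii) $J(\mathrm{PGL}_2(K))=2$ if and only if $-1$ is not a sum of two squares in $K$. Here "sum of two squares in $K$" means $a^2+b^2$ with $a,b\in K$, where $a=0$ or $b=0$ is allowed. -/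

import Mathlib

open scoped MatrixGroups

/-- Every finite subgroup `G` of `Γ` has a normal abelian subgroup `A` with `[G : A] ≤ n`.
(As `G` is finite, `A.index` is the genuine, nonzero, index.) -/
def IsJordanBound (Γ : Type*) [Group Γ] (n : ℕ) : Prop :=
  ∀ G : Subgroup Γ, Finite G →
    ∃ A : Subgroup G, A.Normal ∧ (∀ a ∈ A, ∀ b ∈ A, a * b = b * a) ∧ A.index ≤ n

/-- `J(Γ) = n`: the Jordan constant of `Γ` exists and equals `n`, that is, `n` is the least
integer such that every finite subgroup of `Γ` has a normal abelian subgroup of index at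
most `n`. (A bound is automatically positive, so natural numbers suffice.) -/
def IsJordanConstant (Γ : Type*) [Group Γ] (n : ℕ) : Prop :=
  IsLeast {m : ℕ | IsJordanBound Γ m} n

open MulAction Matrix

open scoped MatrixGroups LinearAlgebra.Projectivization Quaternion

/-! A finite subgroup `G` of `PGL(2, K)` acts on the projective line over the algebraic closure. A
nontrivial element of finite order is semisimple in characteristic 0, so it fixes exactly two points
(its two eigenlines), and point stabilizers are cyclic, since the eigenvalue ratio is a faithful
character. Counting fixed points then yields Klein's list (`IsPolarAction.classification`): `G`
fixes a point (cyclic), or has a point stabilizer of index 2 (dihedral), or has the orbit data of a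
tetrahedral, octahedral or icosahedral group. In the first two cases a stabilizer is a normal
abelian subgroup of index at most 2.

The group theory of the polyhedral cases uses only this orbit data. Types 3 and 4 have a normal
abelian subgroup of index at most 6, and 6 is needed for type 4; in type 5 only the trivial subgroup
is normal abelian, so 60 is needed.

The arithmetic of `K` decides which types occur. An element of order 5 puts a square root of 5 in
`K`. A polyhedral group has two noncommuting elements of order 3; the traces of their products
produce two anticommuting matrices of square `-1`, hence a solution of `a ^ 2 + b ^ 2 = -1`
(`exists_sq_add_sq_of_order_three`). Conversely, such a solution splits Hamilton's quaternions,
whose units 1 + i + j + k, 1 + i - j - k and 1 + i generate an octahedral group in `PGL(2, K)`;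
replacing 1 + i by an icosahedral unit built from the golden ratio gives the icosahedral group. The
lower bound 2 comes from a copy of the symmetric group on three letters, present over every field.
-/

/-- A group action in which every nontrivial element has exactly two fixed points and all point
stabilizers are cyclic, such as that of a finite group of Möbius transformations of the
projective line over an algebraically closed field of characteristic zero. -/
structure IsPolarAction (G P : Type*) [Group G] [MulAction G P] : Prop where
  exists_fixed : ∀ g : G, g ≠ 1 → ∃ x y : P, x ≠ y ∧ ∀ z, g • z = z ↔ z = x ∨ z = y
  isCyclic_stabilizer : ∀ x : P, IsCyclic (stabilizer G x)

/-- The numerical data of the finite rotation groups of the tetrahedron (`m = 3`), the octahedron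
(`m = 4`) and the icosahedron (`m = 5`): there are three orbits of points with nontrivial
stabilizer, of orders `2`, `3` and `m`. -/
def IsPolyhedral (G P : Type*) [Group G] [MulAction G P] (m : ℕ) : Prop :=
  (∃ u v w : P, Nat.card (stabilizer G u) = 2 ∧ Nat.card (stabilizer G v) = 3 ∧
    Nat.card (stabilizer G w) = m ∧
    ∀ z : P, stabilizer G z ≠ ⊥ → z ∈ orbit G u ∨ z ∈ orbit G v ∨ z ∈ orbit G w) ∧
  ((m = 3 ∧ Nat.card G = 12) ∨ (m = 4 ∧ Nat.card G = 24) ∨ (m = 5 ∧ Nat.card G = 60))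

/-! ### Orbit counting and Klein's classification. -/

section

variable {G P : Type*} [Group G] [MulAction G P]

theorem card_stabilizer_eq_of_mem_orbit {x y : P} (h : y ∈ orbit G x) :
    Nat.card (stabilizer G y) = Nat.card (stabilizer G x) :=
  Nat.card_congr (stabilizerEquivStabilizerOfOrbitRel h).toEquiv

namespace IsPolarAction

variable (h : IsPolarAction G P)
include h

theorem commute_of_mem_stabilizer {x : P} {a b : G} (ha : a • x = x) (hb : b • x = x) :
    a * b = b * a := by
  have := h.isCyclic_stabilizer x
  have := (IsCyclic.isMulCommutative (α := stabilizer G x)).is_comm.comm ⟨a, ha⟩ ⟨b, hb⟩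
  simpa using congrArg Subtype.val this

/-- The stabilizer of `x` is abelian, so each of its elements permutes the two fixed points of any
other; as `x` is kept, so is the second one. Thus all nontrivial elements of the stabilizer share
one antipode. -/
theorem exists_opposite {x : P} (hx : stabilizer G x ≠ ⊥) :
    ∃ y, y ≠ x ∧ ∀ g : G, g • x = x → g ≠ 1 → ∀ z, g • z = z ↔ z = x ∨ z = y := by
  obtain ⟨⟨g₀, hg₀⟩, hne⟩ := (Subgroup.ne_bot_iff_exists_ne_one).1 hx
  replace hne : g₀ ≠ 1 := by simpa using hne
  replace hg₀ : g₀ • x = x := hg₀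
  obtain ⟨y, hyx, hy⟩ : ∃ y, y ≠ x ∧ ∀ z, g₀ • z = z ↔ z = x ∨ z = y := by
    obtain ⟨a, b, hab, hz⟩ := h.exists_fixed g₀ hne
    rcases (hz x).1 hg₀ with rfl | rfl
    · exact ⟨b, hab.symm, hz⟩
    · exact ⟨a, hab, fun z => (hz z).trans or_comm⟩
  refine ⟨y, hyx, fun g hg hg1 z => ?_⟩
  have hgy : g • y = y := by
    have h1 : g₀ • g • y = g • y := by
      rw [smul_smul, h.commute_of_mem_stabilizer hg₀ hg, mul_smul, (hy y).2 (Or.inr rfl)]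
    rcases (hy _).1 h1 with h2 | h2
    · exact absurd (MulAction.injective g (h2.trans hg.symm)) hyx
    · exact h2
  obtain ⟨a, b, hab, hz⟩ := h.exists_fixed g hg1
  have h1 := (hz x).1 hg
  have h2 := (hz y).1 hgy
  rw [hz z]
  grind

theorem finite_poles [Finite G] : {x : P | stabilizer G x ≠ ⊥}.Finite := by
  have : {x : P | stabilizer G x ≠ ⊥} ⊆ ⋃ g : {g : G // g ≠ 1}, {z : P | g.1 • z = z} := by
    intro x hx
    obtain ⟨⟨g, hg⟩, hne⟩ := (Subgroup.ne_bot_iff_exists_ne_one).1 hx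
    exact Set.mem_iUnion.2 ⟨⟨g, by simpa using hne⟩, hg⟩
  refine (Set.finite_iUnion fun g => ?_).subset this
  obtain ⟨a, b, -, hz⟩ := h.exists_fixed g.1 g.2
  have : {z : P | g.1 • z = z} = {a, b} := by ext z; simp [hz]
  rw [this]
  exact Set.toFinite _

end IsPolarAction

variable (G P) in
/-- The points with nontrivial stabilizer. -/
def poles : SubMulAction G P where
  carrier := {x : P | stabilizer G x ≠ ⊥}
  smul_mem' g x hx := by
    rw [Set.mem_ofPred_eq, stabilizer_smul_eq_stabilizer_map_conj]
    rwa [Ne, Subgroup.map_eq_bot_iff_of_injective _ (MulAut.conj g).injective]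

theorem stabilizer_poles (x : poles G P) : stabilizer G x = stabilizer G (x : P) := by
  ext g
  simp [mem_stabilizer_iff, Subtype.ext_iff]

namespace IsPolarAction

/-- Burnside's lemma on the poles: the identity fixes all of them, counted orbit by orbit as indices
of stabilizers, and every other element fixes exactly two. -/
theorem sum_index_stabilizer [Finite G] (h : IsPolarAction G P)
    [Fintype (orbitRel.Quotient G (poles G P))] :
    ∑ ω : orbitRel.Quotient G (poles G P), (stabilizer G (ω.out : P)).index
      + 2 * (Nat.card G - 1) = Fintype.card (orbitRel.Quotient G (poles G P)) * Nat.card G := by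
  classical
  have : Finite (poles G P) := h.finite_poles
  have := Fintype.ofFinite G
  have := Fintype.ofFinite (poles G P)
  have key := sum_card_fixedBy_eq_card_orbits_mul_card_group G (poles G P)
  rw [Nat.card_eq_fintype_card]
  refine Eq.trans ?_ key
  rw [← Finset.add_sum_erase _ _ (Finset.mem_univ (1 : G))]
  congr 1
  · have : Fintype.card (fixedBy (poles G P) (1 : G)) = Nat.card (poles G P) := by
      rw [Fintype.card_eq_nat_card]
      exact Nat.card_congr (Equiv.subtypeUnivEquiv (by simp))
    rw [this, Nat.card_congr (selfEquivSigmaOrbitsQuotientStabilizer G (poles G P)),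
      Nat.card_sigma]
    refine Finset.sum_congr rfl fun ω _ => ?_
    rw [stabilizer_poles]
    rfl
  · rw [Finset.sum_congr rfl (g := fun _ => 2), Finset.sum_const, Finset.card_erase_of_mem
      (Finset.mem_univ _), Finset.card_univ, smul_eq_mul, mul_comm]
    intro g hg
    have hg1 : g ≠ 1 := by simpa using hg
    obtain ⟨a, b, hab, hz⟩ := h.exists_fixed g hg1
    have hp : ∀ z : P, g • z = z → z ∈ poles G P := fun z hz =>
      (Subgroup.ne_bot_iff_exists_ne_one).2 ⟨⟨g, hz⟩, fun h => hg1 (congrArg Subtype.val h)⟩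
    have : fixedBy (poles G P) g = {⟨a, hp a ((hz a).2 (Or.inl rfl))⟩,
        ⟨b, hp b ((hz b).2 (Or.inr rfl))⟩} := by
      ext z
      simp [mem_fixedBy, Subtype.ext_iff, hz]
    rw [Fintype.card_eq_nat_card, this, Nat.card_coe_set_eq, Set.ncard_pair]
    simpa using hab

end IsPolarAction

/-- Dividing by `n` gives 1/e₁ + 1/e₂ + 1/e₃ = 1 + 2/n > 1, which has few solutions. The alternative
`k₃ = 2` is the dihedral family. -/
theorem three_orbit_arithmetic {n k₁ k₂ k₃ e₁ e₂ e₃ : ℕ} (h₁ : e₁ * k₁ = n) (h₂ : e₂ * k₂ = n)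
    (h₃ : e₃ * k₃ = n) (h : k₁ + k₂ + k₃ = n + 2) (h2 : 2 ≤ e₁) (h12 : e₁ ≤ e₂) (h23 : e₂ ≤ e₃) :
    k₃ = 2 ∨ (e₁ = 2 ∧ e₂ = 3 ∧
      ((e₃ = 3 ∧ n = 12) ∨ (e₃ = 4 ∧ n = 24) ∨ (e₃ = 5 ∧ n = 60))) := by
  have a1 : e₁ < 3 := by
    by_contra! hc
    have := Nat.mul_le_mul_right k₁ hc
    have := Nat.mul_le_mul_right k₂ (hc.trans h12)
    have := Nat.mul_le_mul_right k₃ ((hc.trans h12).trans h23)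
    omega
  obtain rfl : e₁ = 2 := by omega
  have a2 : e₂ < 4 := by
    by_contra! hc
    have := Nat.mul_le_mul_right k₂ hc
    have := Nat.mul_le_mul_right k₃ (hc.trans h23)
    omega
  obtain rfl | rfl : e₂ = 2 ∨ e₂ = 3 := by omega
  · omega
  · have a3 : e₃ < 6 := by
      by_contra! hc
      have := Nat.mul_le_mul_right k₃ hc
      omega
    interval_cases e₃ <;> omega

theorem isPolyhedral_of_three_orbits {u v w : P}
    (hcov : ∀ z : P, stabilizer G z ≠ ⊥ → z ∈ orbit G u ∨ z ∈ orbit G v ∨ z ∈ orbit G w)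
    (hsum : (stabilizer G u).index + (stabilizer G v).index + (stabilizer G w).index
      = Nat.card G + 2)
    (h2 : 2 ≤ Nat.card (stabilizer G u))
    (h12 : Nat.card (stabilizer G u) ≤ Nat.card (stabilizer G v))
    (h23 : Nat.card (stabilizer G v) ≤ Nat.card (stabilizer G w)) :
    (∃ x : P, (stabilizer G x).index = 2) ∨ ∃ m, IsPolyhedral G P m := by
  rcases three_orbit_arithmetic (stabilizer G u).card_mul_index (stabilizer G v).card_mul_index
    (stabilizer G w).card_mul_index hsum h2 h12 h23 with h | ⟨hu, hv, h⟩
  · exact Or.inl ⟨w, h⟩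
  · exact Or.inr ⟨_, ⟨u, v, w, hu, hv, rfl, hcov⟩, h⟩

/-- Klein's classification, at the level of orbits. -/
theorem IsPolarAction.classification [Finite G] [Nontrivial G] (h : IsPolarAction G P) :
    (∃ x : P, stabilizer G x = ⊤) ∨ (∃ x : P, (stabilizer G x).index = 2) ∨
      ∃ m, IsPolyhedral G P m := by
  classical
  have : Finite (poles G P) := h.finite_poles
  have := Fintype.ofFinite (orbitRel.Quotient G (poles G P))
  have key := h.sum_index_stabilizer
  have hn : 1 < Nat.card G := Finite.one_lt_card
  have hcard (x : poles G P) : 2 ≤ Nat.card (stabilizer G (x : P)) := by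
    have := (Subgroup.one_lt_card_iff_ne_bot (stabilizer G (x : P))).2 x.2
    omega
  have hle (x : poles G P) : 2 * (stabilizer G (x : P)).index ≤ Nat.card G := by
    rw [← (stabilizer G (x : P)).card_mul_index]
    exact Nat.mul_le_mul_right _ (hcard x)
  have hpos (x : poles G P) : 0 < (stabilizer G (x : P)).index :=
    Nat.pos_of_ne_zero Subgroup.index_ne_zero_of_finite
  have hcov (z : P) (hz : stabilizer G z ≠ ⊥) :
      ∃ ω : orbitRel.Quotient G (poles G P), z ∈ orbit G (ω.out : P) := by
    refine ⟨Quotient.mk'' ⟨z, hz⟩, ?_⟩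
    have : (orbitRel G (poles G P)) ⟨z, hz⟩
        (Quotient.out (s := orbitRel G (poles G P)) (Quotient.mk'' ⟨z, hz⟩)) :=
      (orbitRel G (poles G P)).symm' (Quotient.mk_out (s := orbitRel G (poles G P)) (⟨z, hz⟩ : poles G P))
    obtain ⟨g, hg⟩ := this
    exact ⟨g, congrArg Subtype.val hg⟩
  -- Each orbit has at most |G|/2 points, so the counting formula gives r|G|/2 ≤ 2(|G| - 1) < 2|G|,
  -- where r is the number of orbits.
  have hr : Fintype.card (orbitRel.Quotient G (poles G P)) < 4 := by
    have : 2 * ∑ ω : orbitRel.Quotient G (poles G P), (stabilizer G (ω.out : P)).index ≤ Fintype.card (orbitRel.Quotient G (poles G P)) * Nat.card G := by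
      rw [Finset.mul_sum]
      simpa using Finset.sum_le_card_nsmul Finset.univ _ _ fun (ω : orbitRel.Quotient G (poles G P)) _ => hle ω.out
    by_contra! hc
    have := Nat.mul_le_mul_right (Nat.card G) hc
    omega
  have e := Fintype.equivFin (orbitRel.Quotient G (poles G P))
  rw [← e.symm.sum_comp] at key
  generalize hf : Fintype.card (orbitRel.Quotient G (poles G P)) = r at e key hr
  -- No orbit or a single one contradicts |G| > 1; two orbits must both be single points; three give
  -- the equation of `three_orbit_arithmetic` once sorted by stabilizer order.
  interval_cases r
  · rw [Finset.univ_eq_empty, Finset.sum_empty, zero_add, Nat.zero_mul] at key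
    omega
  · simp only [Fin.sum_univ_one] at key
    have := hle (e.symm 0).out
    have := hpos (e.symm 0).out
    omega
  · simp only [Fin.sum_univ_two] at key
    left
    have := hpos (e.symm 0).out
    have := hpos (e.symm 1).out
    exact ⟨(e.symm 0).out, Subgroup.index_eq_one.1 (by omega)⟩
  · simp only [Fin.sum_univ_three] at key
    right
    have hcov' (z : P) (hz : stabilizer G z ≠ ⊥) : z ∈ orbit G ((e.symm 0).out : P) ∨
        z ∈ orbit G ((e.symm 1).out : P) ∨ z ∈ orbit G ((e.symm 2).out : P) := by
      obtain ⟨ω, hω⟩ := hcov z hz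
      obtain ⟨i, rfl⟩ := e.symm.surjective ω
      fin_cases i
      · exact Or.inl hω
      · exact Or.inr (Or.inl hω)
      · exact Or.inr (Or.inr hω)
    have h0 := hcard (e.symm 0).out
    have h1 := hcard (e.symm 1).out
    have h2 := hcard (e.symm 2).out
    generalize ((e.symm 0).out : P) = x at *
    generalize ((e.symm 1).out : P) = y at *
    generalize ((e.symm 2).out : P) = z at *
    rcases le_total (Nat.card (stabilizer G x)) (Nat.card (stabilizer G y)) with hxy | hxy <;>
    rcases le_total (Nat.card (stabilizer G y)) (Nat.card (stabilizer G z)) with hyz | hyz <;>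
    rcases le_total (Nat.card (stabilizer G x)) (Nat.card (stabilizer G z)) with hxz | hxz
    · exact isPolyhedral_of_three_orbits hcov' (by omega) h0 hxy hyz
    · exact isPolyhedral_of_three_orbits hcov' (by omega) h0 hxy hyz
    · exact isPolyhedral_of_three_orbits (u := x) (v := z) (w := y)
        (fun t ht => by have := hcov' t ht; tauto) (by omega) h0 hxz hyz
    · exact isPolyhedral_of_three_orbits (u := z) (v := x) (w := y)
        (fun t ht => by have := hcov' t ht; tauto) (by omega) h2 hxz hxy
    · exact isPolyhedral_of_three_orbits (u := y) (v := x) (w := z)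
        (fun t ht => by have := hcov' t ht; tauto) (by omega) h1 hxy hxz
    · exact isPolyhedral_of_three_orbits (u := y) (v := z) (w := x)
        (fun t ht => by have := hcov' t ht; tauto) (by omega) h1 hyz hxz
    · exact isPolyhedral_of_three_orbits (u := z) (v := y) (w := x)
        (fun t ht => by have := hcov' t ht; tauto) (by omega) h2 hyz hxy
    · exact isPolyhedral_of_three_orbits (u := z) (v := y) (w := x)
        (fun t ht => by have := hcov' t ht; tauto) (by omega) h2 hyz hxy

end

/-! ### Normal abelian subgroups, from the orbit data alone. -/

section

open scoped Pointwise

variable {G P : Type*} [Group G] [MulAction G P]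

theorem smul_smul_eq_of_mem_pair {k : G} {p q : P} (hpq : p ≠ q) (hp : k • p = p ∨ k • p = q)
    (hq : k • q = p ∨ k • q = q) : k • k • p = p := by
  rcases hp with hp | hp
  · rw [hp, hp]
  · rcases hq with hq | hq
    · rw [hp, hq]
    · exact absurd (MulAction.injective k (hp.trans hq.symm)) hpq

theorem smul_mem_pair_of_commute {a g : G} {p q : P} (ha : ∀ z : P, a • z = z ↔ z = p ∨ z = q)
    (hg : g * a = a * g) : (g • p = p ∨ g • p = q) ∧ (g • q = p ∨ g • q = q) := by
  rw [← ha, ← ha, smul_smul, smul_smul, ← hg, mul_smul, mul_smul, (ha p).2 (Or.inl rfl),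
    (ha q).2 (Or.inr rfl)]
  exact ⟨rfl, rfl⟩

theorem index_stabilizer_le_two {p x y : P} (h : ∀ g : G, g • p = x ∨ g • p = y) :
    (stabilizer G p).index ≤ 2 := by
  rw [index_stabilizer]
  have : orbit G p ⊆ {x, y} := by
    rintro _ ⟨g, rfl⟩
    exact h g
  exact (Set.ncard_le_ncard this).trans ((Set.ncard_insert_le _ _).trans (by simp))

theorem mul_comm_of_sq_eq_one {a b : G} (ha : a ^ 2 = 1) (hb : b ^ 2 = 1) (hab : (a * b) ^ 2 = 1) :
    a * b = b * a := by
  rw [sq] at ha hb hab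
  rw [eq_inv_of_mul_eq_one_left hab, _root_.mul_inv_rev, ← eq_inv_of_mul_eq_one_left ha,
    ← eq_inv_of_mul_eq_one_left hb]

theorem exists_pole {g : G} (h : IsPolarAction G P) (hg : g ≠ 1) :
    ∃ z : P, g • z = z ∧ stabilizer G z ≠ ⊥ := by
  obtain ⟨x, y, -, hz⟩ := h.exists_fixed g hg
  have hx := (hz x).2 (Or.inl rfl)
  exact ⟨x, hx, Subgroup.ne_bot_iff_exists_ne_one.2
    ⟨⟨g, hx⟩, fun h => hg (congrArg Subtype.val h)⟩⟩

namespace IsPolarAction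

variable (h : IsPolarAction G P)
include h

/-- If `p` lies in an orbit of size `6` together with its antipode, the elements preserving each
of the three axes through this orbit form an elementary abelian normal subgroup. -/
theorem exists_normal_index_le_six [Finite G] {p : P} (hp : stabilizer G p ≠ ⊥)
    (hcard : Nat.card G = 6 * Nat.card (stabilizer G p))
    (horb : ∀ z : P, Nat.card (stabilizer G z) = Nat.card (stabilizer G p) → z ∈ orbit G p) :
    ∃ A : Subgroup G, A.Normal ∧ (∀ a ∈ A, ∀ b ∈ A, a * b = b * a) ∧ A.index ≤ 6 := by
  obtain ⟨q, hqp, hq⟩ := h.exists_opposite hp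
  have hfix (g : G) (hg : g • p = p) : g • q = q := by
    by_cases hg1 : g = 1
    · rw [hg1, one_smul]
    · exact (hq g hg hg1 q).2 (Or.inr rfl)
  have hfix' (g : G) (hg : g • q = q) : g • p = p := by
    have hle : stabilizer G p ≤ stabilizer G q := fun g hg => hfix g hg
    have hq' : stabilizer G q ≠ ⊥ := fun hb => hp (le_bot_iff.1 (hb ▸ hle))
    obtain ⟨r, hrq, hr⟩ := h.exists_opposite hq'
    by_cases hg1 : g = 1
    · rw [hg1, one_smul]
    obtain ⟨⟨k, hk⟩, hne⟩ := Subgroup.ne_bot_iff_exists_ne_one.1 hp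
    have hk1 : k ≠ 1 := by simpa using hne
    rw [hr g hg hg1, ← hr k (hle hk) hk1]
    exact hk
  have hstab : stabilizer G q = stabilizer G p := by
    ext g
    exact ⟨hfix' g, hfix g⟩
  obtain ⟨k, hk⟩ : q ∈ orbit G p := horb q (by rw [hstab])
  replace hk : k • p = q := hk
  -- `H` preserves the axis through `p` and its antipode. It contains `k`, which swaps them, so its
  -- index is at most 6/2 = 3, and its normal core, the kernel of the action on the cosets, has
  -- index at most 3! = 6.
  let H : Subgroup G := stabilizer G ({p, q} : Set P)
  have hH (g : G) : g ∈ H ↔ ({g • p, g • q} : Set P) = {p, q} := by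
    simp [H, mem_stabilizer_iff, Set.smul_set_insert]
  have hle : stabilizer G p ≤ H := fun g hg => by
    rw [hH, hfix g hg, show g • p = p from hg]
  have hkH : k ∈ H := by
    have h1 : k • q = p := by
      have : k • q ∈ ({p, q} : Set P) := by
        obtain ⟨⟨t, ht⟩, hne⟩ := Subgroup.ne_bot_iff_exists_ne_one.1 hp
        have ht1 : t ≠ 1 := by simpa using hne
        refine (hq t ht ht1 _).1 ?_
        have : k⁻¹ * t * k ∈ stabilizer G q := by
          rw [hstab, mem_stabilizer_iff, mul_smul, mul_smul, hk, hfix t ht, ← hk, inv_smul_smul]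
        rw [mem_stabilizer_iff, mul_smul, mul_smul, inv_smul_eq_iff] at this
        exact this
      rcases this with h1 | h1
      · exact h1
      · exact absurd (MulAction.injective k (h1.trans hk.symm)) hqp
    rw [hH, hk, h1, Set.pair_comm]
  have hindex : H.index ≤ 3 := by
    obtain ⟨c, hc⟩ := Subgroup.card_dvd_of_le hle
    have hc2 : 2 ≤ c := by
      by_contra! hlt
      have : stabilizer G p = H := Subgroup.eq_of_le_of_card_ge hle (by
        rw [hc]
        exact Nat.mul_le_of_le_div _ _ _ (by
          rw [Nat.div_self Nat.card_pos]; omega) |>.trans_eq' (mul_comm _ _) )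
      rw [← this] at hkH
      exact hqp (hk.symm.trans hkH)
    have h1 := H.card_mul_index
    have h2 := Nat.card_pos (α := stabilizer G p)
    by_contra! hlt
    have h3 := Nat.mul_le_mul (Nat.mul_le_mul_left (Nat.card (stabilizer G p)) hc2) hlt
    rw [← hc] at h3
    omega
  -- All conjugates of `g` preserve the axis, so `g ^ 2` fixes the whole orbit of `p`. That orbit
  -- has six points, while a nontrivial element fixes only two.
  have hsq (g : G) (hg : g ∈ H.normalCore) : g ^ 2 = 1 := by
    by_contra hne
    obtain ⟨x, y, -, hxy⟩ := h.exists_fixed _ hne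
    have hle2 := index_stabilizer_le_two (p := p) (x := x) (y := y) fun a => by
      have ha : a⁻¹ * g * a ∈ H := by simpa using hg a⁻¹
      rw [hH] at ha
      have h1 : (a⁻¹ * g * a) • p ∈ ({p, q} : Set P) := ha ▸ Set.mem_insert _ _
      have h2 : (a⁻¹ * g * a) • q ∈ ({p, q} : Set P) :=
        ha ▸ Set.mem_insert_of_mem _ (Set.mem_singleton _)
      have h3 := smul_smul_eq_of_mem_pair hqp.symm h1 h2
      rw [← hxy]
      rw [smul_smul, show a⁻¹ * g * a * (a⁻¹ * g * a) = a⁻¹ * (g ^ 2 * a) by rw [sq]; group, mul_smul,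
        inv_smul_eq_iff, mul_smul] at h3
      exact h3
    have := (stabilizer G p).card_mul_index
    rw [hcard] at this
    have h2 := Nat.card_pos (α := stabilizer G p)
    have h3 := Nat.mul_le_mul_left (Nat.card (stabilizer G p)) hle2
    omega
  refine ⟨H.normalCore, inferInstance, fun a ha b hb =>
    mul_comm_of_sq_eq_one (hsq a ha) (hsq b hb) (hsq _ (mul_mem ha hb)), ?_⟩
  rw [Subgroup.normalCore_eq_ker, Subgroup.index_ker]
  refine (Subgroup.card_le_card_group _).trans ?_
  rw [Nat.card_perm]
  exact Nat.factorial_le hindex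

/-- Conjugate a generator of the stabilizer of `v` by an element moving `v` off its axis. If the two
commuted, the conjugate would preserve the axis; having order 3 it could not swap its ends, so it
would have the same fixed points, against the choice of the conjugator. -/
theorem exists_order_three_not_commute [Finite G] {v : P} (hv : Nat.card (stabilizer G v) = 3)
    (hcard : 6 < Nat.card G) :
    ∃ b c : G, b ≠ 1 ∧ b ^ 3 = 1 ∧ c ≠ 1 ∧ c ^ 3 = 1 ∧ b * c ≠ c * b := by
  have hne : stabilizer G v ≠ ⊥ := by
    rw [← Subgroup.one_lt_card_iff_ne_bot]; omega
  obtain ⟨v', hv', hop⟩ := h.exists_opposite hne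
  obtain ⟨⟨b, hbv⟩, hb⟩ := Subgroup.ne_bot_iff_exists_ne_one.1 hne
  have hb1 : b ≠ 1 := by simpa using hb
  have hb3 : b ^ 3 = 1 := by
    have := pow_card_eq_one' (x := (⟨b, hbv⟩ : stabilizer G v))
    rw [hv] at this
    simpa using congrArg Subtype.val this
  replace hbv : b • v = v := hbv
  obtain ⟨g, hg⟩ : ∃ g : G, ¬ (g • v = v ∨ g • v = v') := by
    by_contra! hcon
    have h1 := index_stabilizer_le_two hcon
    have h2 := (stabilizer G v).card_mul_index
    rw [hv] at h2
    omega
  refine ⟨b, g * b * g⁻¹, hb1, hb3, by simpa using hb1, by rw [conj_pow, hb3]; simp, fun hcomm => ?_⟩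
  obtain ⟨h1, h2⟩ := smul_mem_pair_of_commute (hop b hbv hb1) hcomm.symm
  have hc2 := smul_smul_eq_of_mem_pair hv'.symm h1 h2
  generalize hc : g * b * g⁻¹ = c at *
  have hc3 : c ^ 3 = 1 := by rw [← hc, conj_pow, hb3]; simp
  have hcv : c • v = v := by
    have : c • v = (c ^ 3) • v := by
      rw [pow_succ', sq, mul_smul, mul_smul, hc2]
    rw [this, hc3, one_smul]
  have hc1 : c ≠ 1 := by simpa [← hc] using hb1
  refine hg ((hop c hcv hc1 _).1 ?_)
  rw [← hc, smul_smul, inv_mul_cancel_right, mul_smul, hbv]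

/-- The conjugates of `a` lie in `A` and commute with `a`, hence preserve its pair of fixed points.
So `a ^ 2` fixes the whole orbit of one of them, which has more than two points. -/
theorem sq_eq_one_of_mem_normal (hidx : ∀ x : P, stabilizer G x ≠ ⊥ → 2 < (stabilizer G x).index)
    {A : Subgroup G} (hA : A.Normal) (hcomm : ∀ a ∈ A, ∀ b ∈ A, a * b = b * a) {a : G}
    (ha : a ∈ A) : a ^ 2 = 1 := by
  by_contra hne
  have ha1 : a ≠ 1 := by rintro rfl; simp at hne
  obtain ⟨p, q, hpq, hfix⟩ := h.exists_fixed a ha1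
  obtain ⟨x, y, hxy, hfix2⟩ := h.exists_fixed _ hne
  have hap := (hfix p).2 (Or.inl rfl)
  have hp : stabilizer G p ≠ ⊥ := Subgroup.ne_bot_iff_exists_ne_one.2
    ⟨⟨a, hap⟩, fun h => ha1 (congrArg Subtype.val h)⟩
  refine (hidx p hp).not_ge (index_stabilizer_le_two (x := x) (y := y) fun g => ?_)
  have hc := hA.conj_mem a ha g⁻¹
  obtain ⟨h1, h2⟩ := smul_mem_pair_of_commute hfix (hcomm _ hc _ ha)
  have h3 := smul_smul_eq_of_mem_pair hpq h1 h2
  rw [inv_inv, smul_smul, show g⁻¹ * a * g * (g⁻¹ * a * g) = g⁻¹ * (a ^ 2 * g) by rw [sq]; group, mul_smul,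
    inv_smul_eq_iff, mul_smul] at h3
  exact (hfix2 _).1 h3

/-- `A` preserves the fixed pair of any nontrivial `a ∈ A`, so a stabilizer has index at most 2 in
`A`; being inside a cyclic group and of exponent 2, that stabilizer has order at most 2. -/
theorem card_le_four_of_sq_eq_one [Finite G] {A : Subgroup G}
    (hcomm : ∀ a ∈ A, ∀ b ∈ A, a * b = b * a) (hsq : ∀ a ∈ A, a ^ 2 = 1) : Nat.card A ≤ 4 := by
  by_cases hA : A = ⊥
  · simp [hA]
  obtain ⟨⟨a, ha⟩, hne⟩ := Subgroup.ne_bot_iff_exists_ne_one.1 hA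
  have ha1 : a ≠ 1 := by simpa using hne
  obtain ⟨p, q, hpq, hfix⟩ := h.exists_fixed a ha1
  rw [← (stabilizer A p).card_mul_index]
  have hidx : (stabilizer A p).index ≤ 2 := index_stabilizer_le_two (x := p) (y := q) fun g =>
    (smul_mem_pair_of_commute hfix (hcomm _ g.2 _ ha)).1
  have hcard : Nat.card (stabilizer A p) ≤ 2 := by
    classical
    have := Fintype.ofFinite (stabilizer G p)
    have := h.isCyclic_stabilizer p
    refine le_trans ?_ (IsCyclic.card_pow_eq_one_le (α := stabilizer G p) (n := 2) two_pos)
    rw [← Fintype.card_subtype, Fintype.card_eq_nat_card]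
    refine Nat.card_le_card_of_injective (fun t => ⟨⟨t.1.1, t.2⟩,
      Subtype.ext (hsq _ t.1.2)⟩) fun s t hst => ?_
    exact Subtype.ext (Subtype.ext (congrArg (fun r => (r.1 : G)) hst))
  exact Nat.mul_le_mul hcard hidx

/-- A nontrivial `a ∈ A` has a fixed point whose orbit consists of fixed points of conjugates of
`a`, all in `A`; these number at most 4 · 2 = 8. -/
theorem eq_bot_of_normal [Finite G] {A : Subgroup G} (hA : A.Normal) (hcard : Nat.card A ≤ 4)
    (hidx : ∀ x : P, stabilizer G x ≠ ⊥ → 8 < (stabilizer G x).index) : A = ⊥ := by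
  by_contra hne
  obtain ⟨⟨a, ha⟩, hne⟩ := Subgroup.ne_bot_iff_exists_ne_one.1 hne
  have ha1 : a ≠ 1 := by simpa using hne
  obtain ⟨p, hap, hp⟩ := exists_pole h ha1
  have hchoose (c : G) : ∃ s : Finset P, s.card ≤ 2 ∧ (c ≠ 1 → ∀ z, c • z = z → z ∈ s) := by
    classical
    by_cases hc : c = 1
    · exact ⟨∅, by simp, fun h => absurd hc h⟩
    · obtain ⟨x, y, -, hz⟩ := h.exists_fixed c hc
      exact ⟨{x, y}, Finset.card_le_two, fun _ z h => by simpa using (hz z).1 h⟩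
  choose s hs hs' using hchoose
  classical
  have := Fintype.ofFinite A
  have hsub : orbit G p ⊆ (Finset.univ.biUnion fun c : A => s c : Finset P) := by
    rintro _ ⟨g, rfl⟩
    refine Finset.mem_coe.2 (Finset.mem_biUnion.2 ⟨⟨g * a * g⁻¹, hA.conj_mem a ha g⟩,
      Finset.mem_univ _, hs' _ (by simpa using ha1) _ ?_⟩)
    simp only [smul_smul, inv_mul_cancel_right]
    rw [mul_smul, hap]
  have h1 := Set.ncard_le_ncard hsub
  rw [Set.ncard_coe_finset, ← index_stabilizer] at h1
  have h2 := Finset.card_biUnion_le_card_mul Finset.univ (fun c : A => s c) 2 fun c _ => hs c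
  rw [Finset.card_univ, Fintype.card_eq_nat_card] at h2
  have h3 := hidx p hp
  omega

end IsPolarAction

namespace IsPolyhedral

variable {m : ℕ} (hm : IsPolyhedral G P m)
include hm

theorem le_five : 3 ≤ m ∧ m ≤ 5 := by
  have := hm.2
  omega

theorem card_stabilizer {z : P} (hz : stabilizer G z ≠ ⊥) : Nat.card (stabilizer G z) = 2 ∨
    Nat.card (stabilizer G z) = 3 ∨ Nat.card (stabilizer G z) = m := by
  obtain ⟨⟨u, v, w, hu, hv, hw, hcov⟩, -⟩ := hm
  rcases hcov z hz with h | h | h <;> rw [card_stabilizer_eq_of_mem_orbit h] <;> omega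

theorem le_index_stabilizer {z : P} (hz : stabilizer G z ≠ ⊥) :
    4 ≤ (stabilizer G z).index ∧ (m = 5 → 12 ≤ (stabilizer G z).index) := by
  have h1 := (stabilizer G z).card_mul_index
  rcases hm.2 with ⟨rfl, h2⟩ | ⟨rfl, h2⟩ | ⟨rfl, h2⟩ <;>
  rcases hm.card_stabilizer hz with h3 | h3 | h3 <;>
  · rw [h2, h3] at h1
    omega

theorem pow_eq_one (h : IsPolarAction G P) (g : G) :
    g ^ 2 = 1 ∨ g ^ 3 = 1 ∨ g ^ 4 = 1 ∨ g ^ 5 = 1 := by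
  by_cases hg : g = 1
  · simp [hg]
  obtain ⟨z, hz, hz'⟩ := exists_pole h hg
  have h1 := pow_card_eq_one' (x := (⟨g, hz⟩ : stabilizer G z))
  replace h1 : g ^ Nat.card (stabilizer G z) = 1 := congrArg Subtype.val h1
  have h2 := hm.le_five
  rcases hm.card_stabilizer hz' with h3 | h3 | h3
  · rw [h3] at h1; exact Or.inl h1
  · rw [h3] at h1; exact Or.inr (Or.inl h1)
  · rw [h3] at h1
    obtain rfl | rfl | rfl : m = 3 ∨ m = 4 ∨ m = 5 := by omega
    all_goals simp [h1]

theorem eq_of_orderOf [Finite G] (h : IsPolarAction G P) {g : G} (hg : 3 < orderOf g) :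
    m = orderOf g := by
  have hg1 : g ≠ 1 := by rintro rfl; simp at hg
  obtain ⟨z, hz, hz'⟩ := exists_pole h hg1
  have h1 := Subgroup.orderOf_dvd_natCard (stabilizer G z) hz
  have h2 := hm.le_five
  rcases hm.card_stabilizer hz' with h3 | h3 | h3 <;> rw [h3] at h1
  · have := Nat.le_of_dvd (by omega) h1; omega
  · have := Nat.le_of_dvd (by omega) h1; omega
  · obtain ⟨k, hk⟩ := h1
    have : k < 2 := by
      by_contra! hlt
      have := Nat.mul_le_mul hg hlt
      omega
    interval_cases k <;> omega

theorem exists_order_three_not_commute [Finite G] (h : IsPolarAction G P) :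
    ∃ b c : G, b ≠ 1 ∧ b ^ 3 = 1 ∧ c ≠ 1 ∧ c ^ 3 = 1 ∧ b * c ≠ c * b := by
  obtain ⟨⟨u, v, w, hu, hv, hw, hcov⟩, hcard⟩ := hm
  exact h.exists_order_three_not_commute hv (by omega)

theorem exists_orderOf_eq_five [Finite G] (h5 : m = 5) : ∃ g : G, orderOf g = 5 := by
  have : Fact (Nat.Prime 5) := ⟨by norm_num⟩
  refine exists_prime_orderOf_dvd_card' 5 ?_
  have := hm.2
  omega

theorem exists_normal_index_le_six [Finite G] (h : IsPolarAction G P) (h5 : m ≠ 5) :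
    ∃ A : Subgroup G, A.Normal ∧ (∀ a ∈ A, ∀ b ∈ A, a * b = b * a) ∧ A.index ≤ 6 := by
  obtain ⟨⟨u, v, w, hu, hv, hw, hcov⟩, hcard⟩ := hm
  have hne {z : P} {k : ℕ} (hz : Nat.card (stabilizer G z) = k) (hk : 1 < k) :
      stabilizer G z ≠ ⊥ := by
    rw [← Subgroup.one_lt_card_iff_ne_bot]; omega
  rcases hcard with ⟨rfl, hc⟩ | ⟨rfl, hc⟩ | ⟨rfl, hc⟩
  · refine h.exists_normal_index_le_six (hne hu one_lt_two) (by rw [hc, hu]) fun z hz => ?_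
    rw [hu] at hz
    have h1 := hcov z (hne hz one_lt_two)
    refine h1.resolve_right fun h2 => ?_
    rcases h2 with h2 | h2 <;> have := card_stabilizer_eq_of_mem_orbit h2 <;> omega
  · refine h.exists_normal_index_le_six (hne hw (by norm_num)) (by rw [hc, hw]) fun z hz => ?_
    rw [hw] at hz
    rcases hcov z (hne hz (by norm_num)) with h2 | h2 | h2
    · have := card_stabilizer_eq_of_mem_orbit h2; omega
    · have := card_stabilizer_eq_of_mem_orbit h2; omega
    · exact h2
  · exact absurd rfl h5

theorem card_le_four [Finite G] (h : IsPolarAction G P) {A : Subgroup G} (hA : A.Normal)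
    (hcomm : ∀ a ∈ A, ∀ b ∈ A, a * b = b * a) : Nat.card A ≤ 4 :=
  h.card_le_four_of_sq_eq_one hcomm fun _ ha => h.sq_eq_one_of_mem_normal
    (fun _ hx => by have := (hm.le_index_stabilizer hx).1; omega) hA hcomm ha

theorem six_le_index [Finite G] (h : IsPolarAction G P) (h4 : m = 4) {A : Subgroup G}
    (hA : A.Normal) (hcomm : ∀ a ∈ A, ∀ b ∈ A, a * b = b * a) : 6 ≤ A.index := by
  have h1 := A.card_mul_index
  have h2 := hm.card_le_four h hA hcomm
  have h3 := hm.2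
  by_contra! hlt
  have := Nat.mul_le_mul h2 (Nat.le_of_lt_succ hlt)
  omega

theorem sixty_le_index [Finite G] (h : IsPolarAction G P) (h5 : m = 5) {A : Subgroup G}
    (hA : A.Normal) (hcomm : ∀ a ∈ A, ∀ b ∈ A, a * b = b * a) : 60 ≤ A.index := by
  rw [h.eq_bot_of_normal hA (hm.card_le_four h hA hcomm) fun x hx => by
    have := (hm.le_index_stabilizer hx).2 h5; omega, Subgroup.index_bot]
  have := hm.2
  omega

end IsPolyhedral

end

/-! ### Finite subgroups of `PGL(2, K)` acting on the projective line. -/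

section

theorem mk_eq_one_iff_mem_range_scalar {L : Type*} [Field L] {A : GL (Fin 2) L} :
    (ProjGenLinGroup.mk A : PGL(2, L)) = 1 ↔ A.val ∈ Set.range (scalar (Fin 2)) := by
  rw [ProjGenLinGroup.mk_eq_one, GeneralLinearGroup.mem_center_iff_val_mem_range_scalar]

theorem mem_range_scalar_iff {L : Type*} [Field L] {A : Matrix (Fin 2) (Fin 2) L} :
    A ∈ Set.range (scalar (Fin 2)) ↔ A 0 1 = 0 ∧ A 1 0 = 0 ∧ A 0 0 = A 1 1 := by
  constructor
  · rintro ⟨c, rfl⟩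
    simp
  · rintro ⟨h1, h2, h3⟩
    refine ⟨A 0 0, ?_⟩
    ext i j
    fin_cases i <;> fin_cases j <;> simp [h1, h2, h3]

variable {L : Type*} [Field L]

/-- A nonscalar matrix with a double eigenvalue is parabolic, and in characteristic 0 its powers
stay parabolic. -/
theorem discr_ne_zero_of_isOfFinOrder [CharZero L] {A : GL (Fin 2) L}
    (hA : (ProjGenLinGroup.mk A : PGL(2, L)) ≠ 1)
    (hfin : IsOfFinOrder (ProjGenLinGroup.mk A : PGL(2, L))) : A.val.discr ≠ 0 := by
  intro hdisc
  obtain ⟨n, hn, hpow⟩ := isOfFinOrder_iff_pow_eq_one.1 hfin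
  have hpar : A.IsParabolic := ⟨by rwa [← mk_eq_one_iff_mem_range_scalar], hdisc⟩
  refine (hpar.pow hn.ne').1 ?_
  rwa [← mk_eq_one_iff_mem_range_scalar, map_pow]

theorem mk_smul_mk_eq_self_iff {A : GL (Fin 2) L} {v : Fin 2 → L} (hv : v ≠ 0) :
    (ProjGenLinGroup.mk A : PGL(2, L)) • Projectivization.mk L v hv = Projectivization.mk L v hv ↔
      ∃ c : L, A.val *ᵥ v = c • v := by
  rw [Projectivization.PGL.mk_smul_mk, Projectivization.mk_eq_mk_iff']
  exact exists_congr fun c => eq_comm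

theorem eigenvalue_sq_eq {A : Matrix (Fin 2) (Fin 2) L} {v : Fin 2 → L} (hv : v ≠ 0) {c : L}
    (h : A *ᵥ v = c • v) : c ^ 2 - A.trace * c + A.det = 0 := by
  have h0 := congrFun h 0
  have h1 := congrFun h 1
  simp [mulVec_eq_sum] at h0 h1
  rw [trace_fin_two, det_fin_two]
  have : v 0 ≠ 0 ∨ v 1 ≠ 0 := by
    by_contra! hcon
    exact hv (funext fun i => by fin_cases i <;> simp [hcon])
  rcases this with h | h <;> apply mul_left_cancel₀ h
  · linear_combination (A 1 1 - c) * h0 - A 0 1 * h1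
  · linear_combination (A 0 0 - c) * h1 - A 1 0 * h0

theorem exists_eigenvector {A : Matrix (Fin 2) (Fin 2) L} {c : L}
    (hc : c ^ 2 - A.trace * c + A.det = 0) : ∃ v : Fin 2 → L, v ≠ 0 ∧ A *ᵥ v = c • v := by
  have : (A - scalar (Fin 2) c).det = 0 := by
    rw [← hc, trace_fin_two, det_fin_two, det_fin_two]
    simp
    ring
  obtain ⟨v, hv, h⟩ := exists_mulVec_eq_zero_iff.2 this
  refine ⟨v, hv, ?_⟩
  rw [sub_mulVec, sub_eq_zero] at h
  rw [h]
  ext i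
  fin_cases i <;> simp [mulVec_eq_sum, mul_comm]

theorem mk_eq_mk_of_eigenvalue {A : Matrix (Fin 2) (Fin 2) L} (hA : A.discr ≠ 0) {u v : Fin 2 → L}
    (hu : u ≠ 0) (hv : v ≠ 0) {c : L} (h : A *ᵥ u = c • u) (h' : A *ᵥ v = c • v) :
    Projectivization.mk L u hu = Projectivization.mk L v hv := by
  have u0 := congrFun h 0
  have u1 := congrFun h 1
  have v0 := congrFun h' 0
  have v1 := congrFun h' 1
  simp [mulVec_eq_sum] at u0 u1 v0 v1
  have hD : u 0 * v 1 - u 1 * v 0 = 0 := by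
    by_contra hD
    have h00 : A 0 0 - c = 0 := mul_left_cancel₀ hD (by linear_combination v 1 * u0 - u 1 * v0)
    have h01 : A 0 1 = 0 := mul_left_cancel₀ hD (by linear_combination u 0 * v0 - v 0 * u0)
    have h11 : A 1 1 - c = 0 := mul_left_cancel₀ hD (by linear_combination u 0 * v1 - v 0 * u1)
    refine hA ?_
    rw [discr_fin_two, trace_fin_two, det_fin_two]
    linear_combination (A 0 0 - A 1 1) * (h00 - h11) + 4 * A 1 0 * h01
  rw [Projectivization.mk_eq_mk_iff']
  have hv' : v 0 ≠ 0 ∨ v 1 ≠ 0 := by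
    by_contra! hcon
    exact hv (funext fun i => by fin_cases i <;> simp [hcon])
  rcases hv' with h | h
  · refine ⟨u 0 / v 0, funext fun i => ?_⟩
    fin_cases i <;> simp <;> field_simp
    linear_combination hD
  · refine ⟨u 1 / v 1, funext fun i => ?_⟩
    fin_cases i <;> simp <;> field_simp
    linear_combination -hD

theorem exists_fixed_points [IsAlgClosed L] [CharZero L] {g : PGL(2, L)} (hg : g ≠ 1)
    (hfin : IsOfFinOrder g) :
    ∃ x y : ℙ L (Fin 2 → L), x ≠ y ∧ ∀ z, g • z = z ↔ z = x ∨ z = y := by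
  obtain ⟨A, rfl⟩ := ProjGenLinGroup.mk_surjective g
  have hA := discr_ne_zero_of_isOfFinOrder hg hfin
  obtain ⟨s, hs⟩ := IsAlgClosed.exists_pow_nat_eq A.val.discr two_pos
  have hs0 : s ≠ 0 := by rintro rfl; simp at hs; exact hA hs.symm
  rw [discr_fin_two] at hs
  have hroot (c : L) : c ^ 2 - A.val.trace * c + A.val.det = 0 ↔
      c = (A.val.trace + s) / 2 ∨ c = (A.val.trace - s) / 2 := by
    have : c ^ 2 - A.val.trace * c + A.val.det =
        (c - (A.val.trace + s) / 2) * (c - (A.val.trace - s) / 2) := by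
      linear_combination hs / 4
    rw [this, mul_eq_zero, sub_eq_zero, sub_eq_zero]
  obtain ⟨v, hv, hAv⟩ := exists_eigenvector ((hroot _).2 (Or.inl rfl))
  obtain ⟨w, hw, hAw⟩ := exists_eigenvector ((hroot _).2 (Or.inr rfl))
  refine ⟨.mk L v hv, .mk L w hw, fun hvw => ?_, fun z => ?_⟩
  · obtain ⟨a, rfl⟩ := (Projectivization.mk_eq_mk_iff' L v w hv hw).1 hvw
    rw [mulVec_smul, hAw, smul_comm] at hAv
    have := smul_left_injective L hv hAv
    exact hs0 (by linear_combination -this)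
  · induction z using Projectivization.ind with
    | h u hu =>
    constructor
    · rw [mk_smul_mk_eq_self_iff]
      rintro ⟨c, hc⟩
      rcases (hroot c).1 (eigenvalue_sq_eq hu hc) with rfl | rfl
      · exact Or.inl (mk_eq_mk_of_eigenvalue hA hu hv hc hAv)
      · exact Or.inr (mk_eq_mk_of_eigenvalue hA hu hw hc hAw)
    · rintro (h | h) <;> rw [h, mk_smul_mk_eq_self_iff]
      · exact ⟨_, hAv⟩
      · exact ⟨_, hAw⟩

theorem isCyclic_of_fixed_point [CharZero L] {H : Type*} [Group H] [Finite H]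
    (f : H →* PGL(2, L)) (hf : Function.Injective f) (x : ℙ L (Fin 2 → L))
    (hx : ∀ h : H, f h • x = x) : IsCyclic H := by
  induction x using Projectivization.ind with
  | h v hv =>
  have hlift (h : H) : ∃ A : GL (Fin 2) L, ProjGenLinGroup.mk A = f h ∧
      ∃ c : L, A.val *ᵥ v = c • v := by
    obtain ⟨A, hA⟩ := ProjGenLinGroup.mk_surjective (f h)
    refine ⟨A, hA, ?_⟩
    rw [← mk_smul_mk_eq_self_iff hv, hA]
    exact hx h
  choose A hA c hc using hlift
  have hmul (g h : H) : ∃ u : L, u ≠ 0 ∧ (A (g * h)).val = u • ((A g).val * (A h).val) := by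
    obtain ⟨u, hu⟩ := ProjGenLinGroup.mk_eq_mk_iff.1
      (show ProjGenLinGroup.mk (A g * A h) = ProjGenLinGroup.mk (A (g * h)) by
        rw [map_mul, hA, hA, hA, map_mul])
    refine ⟨u, u.ne_zero, ?_⟩
    rw [← hu]
    ext i j
    simp [mul_comm]
  have hdet (h : H) : (A h).val.det ≠ 0 := (A h).det_ne_zero
  have hmap (g h : H) : c (g * h) ^ 2 / (A (g * h)).val.det =
      (c g ^ 2 / (A g).val.det) * (c h ^ 2 / (A h).val.det) := by
    obtain ⟨u, hu, hgh⟩ := hmul g h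
    have : c (g * h) = u * (c g * c h) := by
      have h1 := hc (g * h)
      rw [hgh, smul_mulVec, ← mulVec_mulVec, hc, mulVec_smul, hc, smul_smul, smul_smul] at h1
      rw [← smul_left_injective L hv h1]
      ring
    rw [this, hgh, det_smul, det_mul]
    have := hdet g
    have := hdet h
    simp
    field_simp
  have hc0 (h : H) : c h ≠ 0 := by
    intro h0
    have := eigenvalue_sq_eq hv (hc h)
    rw [h0] at this
    exact hdet h (by linear_combination this)
  have hone : c 1 ^ 2 / (A 1).val.det = 1 := by
    have := hmap 1 1
    rw [mul_one] at this
    exact (mul_eq_left₀ (div_ne_zero (pow_ne_zero 2 (hc0 1)) (hdet 1))).1 this.symm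
  -- As the determinant is the product of the eigenvalues, this is the eigenvalue on the fixed line
  -- divided by the other one, so it does not depend on the lift. The value 1 means a double
  -- eigenvalue, excluded by finite order.
  let χ : H →* L := ⟨⟨fun h => c h ^ 2 / (A h).val.det, hone⟩, hmap⟩
  refine isCyclic_of_injective_ringHom χ ((injective_iff_map_eq_one χ).2 fun h hh => ?_)
  by_contra hne
  have hfh : f h ≠ 1 := fun h1 => hne (hf (h1.trans (map_one f).symm))
  refine discr_ne_zero_of_isOfFinOrder (A := A h) (by rwa [hA])
    (by rw [hA]; exact f.isOfFinOrder (isOfFinOrder_of_finite h)) ?_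
  have h1 : c h ^ 2 = (A h).val.det := by
    have : c h ^ 2 / (A h).val.det = 1 := hh
    rwa [div_eq_one_iff_eq (hdet h)] at this
  have h2 := eigenvalue_sq_eq hv (hc h)
  have h3 : (A h).val.trace = 2 * c h := mul_left_cancel₀ (hc0 h) (by linear_combination -h1 - h2)
  rw [discr_fin_two, h3]
  linear_combination 4 * h1

theorem projGenLinGroup_map_injective {K : Type*} [Field K] (f : K →+* L) :
    Function.Injective (ProjGenLinGroup.map (n := Fin 2) f) := by
  refine (injective_iff_map_eq_one _).2 fun g hg => ?_
  obtain ⟨A, rfl⟩ := ProjGenLinGroup.mk_surjective g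
  rw [ProjGenLinGroup.map_mk, mk_eq_one_iff_mem_range_scalar, mem_range_scalar_iff] at hg
  rw [mk_eq_one_iff_mem_range_scalar, mem_range_scalar_iff]
  simpa [f.injective.eq_iff] using hg

/-- A finite subgroup of `PGL(2, K)` acts on the projective line over the algebraic closure with
exactly two fixed points for each nontrivial element, and with cyclic stabilizers. -/
theorem exists_isPolarAction {K : Type*} [Field K] [CharZero K] (G : Subgroup PGL(2, K))
    [Finite G] :
    ∃ _ : MulAction G (ℙ (AlgebraicClosure K) (Fin 2 → AlgebraicClosure K)),
      IsPolarAction G (ℙ (AlgebraicClosure K) (Fin 2 → AlgebraicClosure K)) := by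
  let φ : G →* PGL(2, AlgebraicClosure K) :=
    (ProjGenLinGroup.map (n := Fin 2) (algebraMap K (AlgebraicClosure K))).comp G.subtype
  have hφ : Function.Injective φ :=
    (projGenLinGroup_map_injective (algebraMap K (AlgebraicClosure K))).comp G.subtype_injective
  let := MulAction.compHom (ℙ (AlgebraicClosure K) (Fin 2 → AlgebraicClosure K)) φ
  refine ⟨this, ?_, ?_⟩
  · intro g hg
    exact exists_fixed_points (g := φ g) (fun h => hg (hφ (h.trans (map_one φ).symm)))
      (φ.isOfFinOrder (isOfFinOrder_of_finite g))
  · intro x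
    exact isCyclic_of_fixed_point (φ.comp (stabilizer G x).subtype)
      (hφ.comp (stabilizer G x).subtype_injective) x fun h => h.2

end

/-! ### Traces of elements of small order and the resulting equations in `K`. -/

section

variable {K : Type*} [Field K]

theorem pow_succ_eq_of_pow_eq {M : Matrix (Fin 2) (Fin 2) K} {n : ℕ} {p q : K}
    (h : M ^ n = p • M + q • 1) :
    M ^ (n + 1) = (M.trace * p + q) • M + (-(M.det * p)) • 1 := by
  rw [pow_succ, h, trace_fin_two, det_fin_two]
  ext i j
  fin_cases i <;> fin_cases j <;> simp [mul_apply] <;> ring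

theorem eq_zero_of_pow_mem_range_scalar {M : Matrix (Fin 2) (Fin 2) K} {n : ℕ} {p q : K}
    (hM : M ∉ Set.range (scalar (Fin 2))) (hn : M ^ n ∈ Set.range (scalar (Fin 2)))
    (h : M ^ n = p • M + q • 1) : p = 0 := by
  rw [h, mem_range_scalar_iff] at hn
  rw [mem_range_scalar_iff] at hM
  by_contra hp
  simp [hp] at hn
  exact hM hn

/-- The relations between trace and determinant of elements of small order. -/
theorem trace_det_of_pow_eq_one {A : GL (Fin 2) K}
    (hA : (ProjGenLinGroup.mk A : PGL(2, K)) ≠ 1) :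
    ((ProjGenLinGroup.mk A : PGL(2, K)) ^ 2 = 1 → A.val.trace = 0) ∧
    ((ProjGenLinGroup.mk A : PGL(2, K)) ^ 3 = 1 → A.val.trace ^ 2 - A.val.det = 0) ∧
    ((ProjGenLinGroup.mk A : PGL(2, K)) ^ 4 = 1 →
      A.val.trace ^ 3 - 2 * A.val.trace * A.val.det = 0) ∧
    ((ProjGenLinGroup.mk A : PGL(2, K)) ^ 5 = 1 →
      A.val.trace ^ 4 - 3 * A.val.trace ^ 2 * A.val.det + A.val.det ^ 2 = 0) := by
  rw [Ne, mk_eq_one_iff_mem_range_scalar] at hA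
  simp only [← map_pow, mk_eq_one_iff_mem_range_scalar, Units.val_pow_eq_pow_val]
  have h1 : A.val ^ 1 = (1 : K) • A.val + (0 : K) • 1 := by simp
  have h2 := pow_succ_eq_of_pow_eq h1
  have h3 := pow_succ_eq_of_pow_eq h2
  have h4 := pow_succ_eq_of_pow_eq h3
  have h5 := pow_succ_eq_of_pow_eq h4
  refine ⟨fun h => ?_, fun h => ?_, fun h => ?_, fun h => ?_⟩
  · have := eq_zero_of_pow_mem_range_scalar hA h h2
    linear_combination this
  · have := eq_zero_of_pow_mem_range_scalar hA h h3
    linear_combination this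
  · have := eq_zero_of_pow_mem_range_scalar hA h h4
    linear_combination this
  · have := eq_zero_of_pow_mem_range_scalar hA h h5
    linear_combination this

theorem exists_sq_eq_five {g : PGL(2, K)} (hg : orderOf g = 5) : ∃ c : K, c ^ 2 = 5 := by
  obtain ⟨A, rfl⟩ := ProjGenLinGroup.mk_surjective g
  have hA : (ProjGenLinGroup.mk A : PGL(2, K)) ≠ 1 := by
    intro h
    rw [h, orderOf_one] at hg
    omega
  have h := (trace_det_of_pow_eq_one hA).2.2.2 (hg ▸ pow_orderOf_eq_one _)
  have hd : A.val.det ≠ 0 := A.det_ne_zero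
  -- With y = tr²/det, order 5 gives y² - 3y + 1 = 0, that is (2y - 3)² = 5.
  refine ⟨2 * A.val.trace ^ 2 / A.val.det - 3, ?_⟩
  field_simp
  linear_combination 4 * h

/-- Lifts of elements of order three can be normalized. -/
theorem exists_lift_of_pow_three {b : PGL(2, K)} (hb : b ≠ 1) (hb3 : b ^ 3 = 1) :
    ∃ B : GL (Fin 2) K, ProjGenLinGroup.mk B = b ∧ B.val.trace = 1 ∧ B.val.det = 1 := by
  obtain ⟨A, rfl⟩ := ProjGenLinGroup.mk_surjective b
  have h := (trace_det_of_pow_eq_one hb).2.1 hb3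
  have hd : A.val.det ≠ 0 := A.det_ne_zero
  have ht : A.val.trace ≠ 0 := by
    intro h0
    exact hd (by rw [h0] at h; linear_combination -h)
  refine ⟨A * GeneralLinearGroup.scalar (Fin 2) (Units.mk0 _ (inv_ne_zero ht)),
    (ProjGenLinGroup.mk_eq_mk_iff.2 ⟨_, rfl⟩).symm, ?_, ?_⟩
  · rw [trace_fin_two] at ht ⊢
    simp [trace_fin_two, mul_apply, ← add_mul, ht]
  · rw [Units.val_mul, det_mul]
    simp
    field_simp
    linear_combination -h

/-- A split quaternion algebra generated by anticommuting elements of square `-1` is isotropic. -/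
theorem exists_sq_add_sq_of_anticommute {I J : Matrix (Fin 2) (Fin 2) K} (hI : I.trace = 0)
    (hJ : J.trace = 0) (hI' : I.det = 1) (hJ' : J.det = 1) (hIJ : (I * J).trace = 0) :
    ∃ a b : K, a ^ 2 + b ^ 2 = -1 := by
  simp only [trace_fin_two, det_fin_two, mul_apply, Fin.sum_univ_two] at *
  generalize I 0 0 = p at *
  generalize I 0 1 = q at *
  generalize I 1 0 = r at *
  generalize J 0 0 = s at *
  generalize J 0 1 = t at *
  generalize J 1 0 = u at *
  generalize I 1 1 = p' at *
  generalize J 1 1 = s' at *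
  obtain rfl : p' = -p := by linear_combination hI
  obtain rfl : s' = -s := by linear_combination hJ
  -- The three terms are the lower-left entries of `I`, `J` and `I * J`. Outside characteristic 2
  -- these are, up to a common factor, the coordinates in that basis of the nilpotent matrix unit
  -- with upper-right entry 1; its determinant, a multiple of the sum of their squares, is 0.
  have key : r ^ 2 + u ^ 2 + (r * s - p * u) ^ 2 = 0 := by
    linear_combination -r ^ 2 * hJ' - u ^ 2 * hI' - r * u * hIJ
  by_cases hz : r * s - p * u = 0
  · rw [hz] at key
    by_cases hu : u = 0
    · subst hu
      exact ⟨s, 0, by linear_combination -hJ'⟩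
    · refine ⟨r / u, 0, ?_⟩
      field_simp
      linear_combination key
  · refine ⟨r / (r * s - p * u), u / (r * s - p * u), ?_⟩
    field_simp
    linear_combination key

theorem trace_cases_of_pow_eq_one {M : GL (Fin 2) K} (hdet : M.val.det = 1)
    (hM : (ProjGenLinGroup.mk M : PGL(2, K)) ≠ 1)
    (hpow : (ProjGenLinGroup.mk M : PGL(2, K)) ^ 2 = 1 ∨ (ProjGenLinGroup.mk M : PGL(2, K)) ^ 3 = 1 ∨
      (ProjGenLinGroup.mk M : PGL(2, K)) ^ 4 = 1 ∨ (ProjGenLinGroup.mk M : PGL(2, K)) ^ 5 = 1) :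
    M.val.trace = 0 ∨ M.val.trace = 1 ∨ M.val.trace = -1 ∨ M.val.trace ^ 2 = 2 ∨
      M.val.trace ^ 2 = M.val.trace + 1 ∨ M.val.trace ^ 2 = 1 - M.val.trace := by
  obtain ⟨h2, h3, h4, h5⟩ := trace_det_of_pow_eq_one hM
  rw [hdet] at h3 h4 h5
  generalize M.val.trace = x at *
  rcases hpow with h | h | h | h
  · exact Or.inl (h2 h)
  · have : (x - 1) * (x + 1) = 0 := by linear_combination h3 h
    rcases mul_eq_zero.1 this with h | h
    · exact Or.inr (Or.inl (by linear_combination h))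
    · exact Or.inr (Or.inr (Or.inl (by linear_combination h)))
  · have : x * (x ^ 2 - 2) = 0 := by linear_combination h4 h
    rcases mul_eq_zero.1 this with h | h
    · exact Or.inl h
    · exact Or.inr (Or.inr (Or.inr (Or.inl (by linear_combination h))))
  · have : (x ^ 2 - x - 1) * (x ^ 2 + x - 1) = 0 := by linear_combination h5 h
    rcases mul_eq_zero.1 this with h | h
    · exact Or.inr (Or.inr (Or.inr (Or.inr (Or.inl (by linear_combination h)))))
    · exact Or.inr (Or.inr (Or.inr (Or.inr (Or.inr (by linear_combination h)))))

theorem trace_cases_of_add_eq_one [CharZero K] {x y : K} (hxy : y = 1 - x)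
    (hx : x = 0 ∨ x = 1 ∨ x = -1 ∨ x ^ 2 = 2 ∨ x ^ 2 = x + 1 ∨ x ^ 2 = 1 - x)
    (hy : y = 0 ∨ y = 1 ∨ y = -1 ∨ y ^ 2 = 2 ∨ y ^ 2 = y + 1 ∨ y ^ 2 = 1 - y) :
    x = 0 ∨ y = 0 ∨ x ^ 2 = x + 1 := by
  subst hxy
  rcases hx with h | h | h | h | h | h
  · exact Or.inl h
  · exact Or.inr (Or.inl (by rw [h, sub_self]))
  · exfalso; subst h; norm_num at hy
  · rcases hy with h' | h' | h' | h' | h' | h' <;> grind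
  · exact Or.inr (Or.inr h)
  · rcases hy with h' | h' | h' | h' | h' | h' <;> grind

theorem mul_one_sub_of_trace_one {B : Matrix (Fin 2) (Fin 2) K} (hBt : B.trace = 1)
    (hBd : B.det = 1) : B * (1 - B) = 1 := by
  rw [trace_fin_two] at hBt
  rw [det_fin_two] at hBd
  ext i j
  fin_cases i <;> fin_cases j <;> simp [mul_apply] <;> grind

theorem det_add_sub_one_of_trace_one {B C : Matrix (Fin 2) (Fin 2) K} (hBt : B.trace = 1)
    (hBd : B.det = 1) (hCt : C.trace = 1) (hCd : C.det = 1) :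
    (B + C - 1).det = 2 - (B * C).trace ∧ (B - C).det = 1 + (B * C).trace ∧
      ((B + C - 1) * (B - C)).trace = 0 := by
  simp only [trace_fin_two, det_fin_two] at *
  simp [mul_apply]
  refine ⟨?_, ?_, ?_⟩
  · linear_combination hBd + hCd - hBt + (C 0 0 + C 1 1) * hBt
  · linear_combination hBd + hCd - (C 0 0 + C 1 1) * hBt - hCt
  · linear_combination (B 0 0 + B 1 1) * hBt - (C 0 0 + C 1 1) * hCt - 2 * hBd + 2 * hCd

/-- Here `1 - B` is the inverse of `B`. As in the binary tetrahedral group, `B * C` has square `-1`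
and anticommutes with its conjugate by `B`. -/
theorem exists_sq_add_sq_of_trace_mul_eq_zero {B C : Matrix (Fin 2) (Fin 2) K}
    (hBt : B.trace = 1) (hBd : B.det = 1) (hCt : C.trace = 1) (hCd : C.det = 1)
    (hBC : (B * C).trace = 0) : ∃ x y : K, x ^ 2 + y ^ 2 = -1 := by
  have hB := mul_one_sub_of_trace_one hBt hBd
  have hC := mul_one_sub_of_trace_one hCt hCd
  have hB' : (1 - B) * B = 1 := mul_eq_one_comm.1 hB
  have hBB : B * B = B - 1 := by rw [← hB]; noncomm_ring
  have hCC : C * C = C - 1 := by rw [← hC]; noncomm_ring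
  have hd : (1 - B).det = 1 := by
    have := congrArg det hB
    rwa [det_mul, hBd, one_mul, det_one] at this
  refine exists_sq_add_sq_of_anticommute (I := B * C) (J := B * (B * C) * (1 - B)) hBC ?_
    (by rw [det_mul, hBd, hCd, one_mul]) (by simp only [det_mul, hBd, hCd, hd, one_mul]) ?_
  · rw [trace_mul_comm, ← mul_assoc, hB', one_mul, hBC]
  · rw [← mul_assoc, trace_mul_comm, show (1 - B) * (B * C * (B * (B * C))) =
      ((1 - B) * B) * C * (B * B) * C by noncomm_ring, hB', one_mul, trace_mul_comm, ← mul_assoc,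
      hCC, hBB, show (C - 1) * (B - 1) = C * B - C - B + 1 by noncomm_ring, trace_add, trace_sub,
      trace_sub, trace_mul_comm, hBC, hBt, hCt, trace_one]
    norm_num

/-- Two distinct rotations of order three whose products have order at most five force `-1` to be
a sum of two squares. -/
theorem exists_sq_add_sq_of_order_three [CharZero K] {b c : PGL(2, K)} (hb : b ≠ 1)
    (hb3 : b ^ 3 = 1) (hc : c ≠ 1) (hc3 : c ^ 3 = 1) (hbc : b * c ≠ c * b)
    (h₁ : (b * c) ^ 2 = 1 ∨ (b * c) ^ 3 = 1 ∨ (b * c) ^ 4 = 1 ∨ (b * c) ^ 5 = 1)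
    (h₂ : (b * c⁻¹) ^ 2 = 1 ∨ (b * c⁻¹) ^ 3 = 1 ∨ (b * c⁻¹) ^ 4 = 1 ∨ (b * c⁻¹) ^ 5 = 1) :
    ∃ x y : K, x ^ 2 + y ^ 2 = -1 := by
  have hne₁ : b * c ≠ 1 := by
    intro h
    rw [eq_inv_of_mul_eq_one_left h] at hbc
    simp at hbc
  have hne₂ : b * c⁻¹ ≠ 1 := by
    intro h
    rw [mul_inv_eq_one] at h
    exact hbc (by rw [h])
  obtain ⟨B, rfl, hBt, hBd⟩ := exists_lift_of_pow_three hb hb3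
  obtain ⟨C, rfl, hCt, hCd⟩ := exists_lift_of_pow_three hc hc3
  have hCinv : (C⁻¹).val = 1 - C.val := by
    exact Units.inv_eq_of_mul_eq_one_right (mul_one_sub_of_trace_one hCt hCd)
  rw [← map_mul] at h₁ hne₁
  rw [← map_inv, ← map_mul] at h₂ hne₂
  have hd₁ : (B * C).val.det = 1 := by rw [Units.val_mul, det_mul, hBd, hCd, one_mul]
  have hCd' : (C⁻¹).val.det = 1 := by
    rw [hCinv, ← hCd]
    rw [trace_fin_two] at hCt
    simp only [det_fin_two]
    simp
    linear_combination -hCt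
  have hd₂ : (B * C⁻¹).val.det = 1 := by rw [Units.val_mul, det_mul, hBd, hCd', one_mul]
  have hx := trace_cases_of_pow_eq_one hd₁ hne₁ h₁
  have hy := trace_cases_of_pow_eq_one hd₂ hne₂ h₂
  rw [Units.val_mul] at hx hy hd₁ hd₂
  have hxy : (B.val * (C⁻¹).val).trace = 1 - (B.val * C.val).trace := by
    rw [hCinv, mul_sub, trace_sub, mul_one, hBt]
  have hC't : (C⁻¹).val.trace = 1 := by
    rw [hCinv, trace_sub, hCt, trace_one]
    norm_num
  -- The traces of BC and BC⁻¹ add up to tr B · tr C = 1. Among the values allowed for order at most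
  -- 5, this leaves a zero trace or a golden ratio.
  rcases trace_cases_of_add_eq_one hxy hx hy with h | h | h
  · exact exists_sq_add_sq_of_trace_mul_eq_zero hBt hBd hCt hCd h
  · exact exists_sq_add_sq_of_trace_mul_eq_zero hBt hBd hC't hCd' h
  · obtain ⟨h1, h2, h3⟩ := det_add_sub_one_of_trace_one hBt hBd hCt hCd
    generalize (B.val * C.val).trace = x at h h1 h2
    have hx0 : x ≠ 0 := by
      rintro rfl
      norm_num at h
    -- The traceless parts of `B` and `C` have equal norm, so their sum and difference are
    -- orthogonal. Their norms 2 - x and 1 + x = x² become 1 after scaling by x and x⁻¹.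
    refine exists_sq_add_sq_of_anticommute (I := x • (B.val + C.val - 1))
      (J := x⁻¹ • (B.val - C.val)) ?_ ?_ ?_ ?_ ?_
    · rw [trace_smul, trace_sub, trace_add, hBt, hCt, trace_one]
      norm_num
    · rw [trace_smul, trace_sub, hBt, hCt, sub_self, smul_zero]
    · rw [det_smul, h1, Fintype.card_fin]
      linear_combination (1 - x) * h
    · rw [det_smul, h2, Fintype.card_fin, add_comm, ← h]
      field_simp
    · rw [smul_mul_smul_comm, trace_smul, h3, smul_zero]

end

/-! ### Upper bounds for the Jordan constant. -/

section

universe u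

variable {K : Type u} [Field K] [CharZero K]

theorem exists_index_le_two_or_isPolyhedral (G : Subgroup PGL(2, K)) [Finite G] :
    (∃ A : Subgroup G, A.Normal ∧ (∀ a ∈ A, ∀ b ∈ A, a * b = b * a) ∧ A.index ≤ 2) ∨
      ∃ (P : Type u) (_ : MulAction G P) (m : ℕ), IsPolarAction G P ∧ IsPolyhedral G P m := by
  rcases subsingleton_or_nontrivial G with hG | hG
  · exact Or.inl ⟨⊤, inferInstance, fun a _ b _ => Subsingleton.elim _ _, by simp⟩
  obtain ⟨act, h⟩ := exists_isPolarAction G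
  have hstab {x : ℙ (AlgebraicClosure K) (Fin 2 → AlgebraicClosure K)} :
      ∀ a ∈ stabilizer G x, ∀ b ∈ stabilizer G x, a * b = b * a :=
    fun a ha b hb => h.commute_of_mem_stabilizer ha hb
  rcases h.classification with ⟨x, hx⟩ | ⟨x, hx⟩ | ⟨m, hm⟩
  · exact Or.inl ⟨stabilizer G x, by rw [hx]; infer_instance, hstab, by simp [hx]⟩
  · exact Or.inl ⟨stabilizer G x, Subgroup.normal_of_index_eq_two hx, hstab, hx.le⟩
  · exact Or.inr ⟨_, act, m, h, hm⟩

theorem exists_sq_add_sq_of_isPolyhedral {G : Subgroup PGL(2, K)} [Finite G] {P : Type*}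
    [MulAction G P] {m : ℕ} (h : IsPolarAction G P) (hm : IsPolyhedral G P m) :
    ∃ a b : K, a ^ 2 + b ^ 2 = -1 := by
  obtain ⟨b, c, hb, hb3, hc, hc3, hbc⟩ := hm.exists_order_three_not_commute h
  have hpow (g : G) : (g : PGL(2, K)) ^ 2 = 1 ∨ (g : PGL(2, K)) ^ 3 = 1 ∨
      (g : PGL(2, K)) ^ 4 = 1 ∨ (g : PGL(2, K)) ^ 5 = 1 := by
    simpa [Subtype.ext_iff] using hm.pow_eq_one h g
  refine exists_sq_add_sq_of_order_three (b := b) (c := c) ?_ ?_ ?_ ?_ ?_ ?_ ?_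
  · simpa using hb
  · exact congrArg Subtype.val hb3
  · simpa using hc
  · exact congrArg Subtype.val hc3
  · exact fun h => hbc (Subtype.ext h)
  · exact hpow (b * c)
  · exact hpow (b * c⁻¹)

theorem isJordanBound_sixty : IsJordanBound PGL(2, K) 60 := by
  intro G hG
  rcases exists_index_le_two_or_isPolyhedral G with ⟨A, hA, hc, h⟩ | ⟨P, _, m, -, hm⟩
  · exact ⟨A, hA, hc, by omega⟩
  · refine ⟨⊥, inferInstance, by simp, ?_⟩
    rw [Subgroup.index_bot]
    have := hm.2
    omega

theorem isJordanBound_six (h5 : ¬ ∃ c : K, c ^ 2 = 5) : IsJordanBound PGL(2, K) 6 := by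
  intro G hG
  rcases exists_index_le_two_or_isPolyhedral G with ⟨A, hA, hc, h⟩ | ⟨P, _, m, h, hm⟩
  · exact ⟨A, hA, hc, by omega⟩
  · refine hm.exists_normal_index_le_six h fun hm5 => h5 ?_
    obtain ⟨g, hg⟩ := hm.exists_orderOf_eq_five hm5
    exact exists_sq_eq_five (g := (g : PGL(2, K))) (by rw [Subgroup.orderOf_coe, hg])

theorem isJordanBound_two (h1 : ¬ ∃ a b : K, a ^ 2 + b ^ 2 = -1) : IsJordanBound PGL(2, K) 2 := by
  intro G hG
  rcases exists_index_le_two_or_isPolyhedral G with h | ⟨P, _, m, h, hm⟩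
  · exact h
  · exact absurd (exists_sq_add_sq_of_isPolyhedral h hm) h1

/-- Recognizes a polyhedral group from three elements, without computing its order. An abelian
subgroup of index at most 2 would contain every `x` with `x ^ 3 = 1`, since then x = x⁴ is the
square of a square, and so `b` and `c` would commute. -/
theorem exists_isPolyhedral_orderOf {G : Subgroup PGL(2, K)} [Finite G] {b c g : PGL(2, K)}
    (hb : b ∈ G) (hb3 : b ^ 3 = 1) (hc : c ∈ G) (hc3 : c ^ 3 = 1) (hbc : b * c ≠ c * b)
    (hg : g ∈ G) (hg3 : 3 < orderOf g) :
    ∃ (P : Type u) (_ : MulAction G P),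
      IsPolarAction G P ∧ IsPolyhedral G P (orderOf g) := by
  rcases exists_index_le_two_or_isPolyhedral G with ⟨A, hA, hcomm, h⟩ | ⟨P, act, m, h, hm⟩
  · exfalso
    have hmem (x : G) (hx : x ^ 3 = 1) : x ∈ A := by
      have hi : A.index ≠ 0 := Subgroup.index_ne_zero_of_finite
      obtain h1 | h2 : A.index = 1 ∨ A.index = 2 := by omega
      · rw [Subgroup.index_eq_one.1 h1]
        exact Subgroup.mem_top x
      · have := pow_mem (Subgroup.sq_mem_of_index_two h2 x) 2
        rwa [← pow_mul, show x ^ (2 * 2) = x ^ 3 * x by rw [← pow_succ], hx, one_mul] at this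
    exact hbc (congrArg Subtype.val
      (hcomm _ (hmem ⟨b, hb⟩ (Subtype.ext hb3)) _ (hmem ⟨c, hc⟩ (Subtype.ext hc3))))
  · refine ⟨P, act, h, ?_⟩
    have := hm.eq_of_orderOf h (g := ⟨g, hg⟩) (by rwa [Subgroup.orderOf_mk])
    rwa [this, Subgroup.orderOf_mk] at hm

end

/-! ### Finite groups as stabilizers of finite sets under conjugation. -/

section

/-- The units of a monoid that preserve a set under conjugation. -/
def conjStabilizer {R : Type*} [Monoid R] (S : Set R) : Subgroup Rˣ where
  carrier := {g | ∀ s, s ∈ S ↔ (g : R) * s * (g⁻¹ : Rˣ) ∈ S}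
  one_mem' := by simp
  mul_mem' {g h} hg hh s := by
    rw [hh s, hg]
    simp only [_root_.mul_inv_rev, Units.val_mul, mul_assoc]
  inv_mem' {g} hg s := by
    rw [hg (_ * _ * _)]
    simp [mul_assoc]

theorem mem_conjStabilizer_of_forall {R : Type*} [Monoid R] {S : Set R} (hS : S.Finite) {g : Rˣ}
    (h : ∀ s ∈ S, ∃ t ∈ S, (g : R) * s = t * g) : g ∈ conjStabilizer S := by
  have hmaps : Set.MapsTo (fun s : R => (g : R) * s * (g⁻¹ : Rˣ)) S S := by
    intro s hs
    obtain ⟨t, ht, hst⟩ := h s hs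
    simpa [hst, mul_assoc] using ht
  have hinj : Function.Injective (fun s : R => (g : R) * s * (g⁻¹ : Rˣ)) := by
    intro s t hst
    simpa using hst
  have hbij := (hS.injOn_iff_bijOn_of_mapsTo hmaps).1 hinj.injOn
  refine fun s => ⟨fun hs => hmaps hs, fun hs => ?_⟩
  obtain ⟨t, ht, hts⟩ := hbij.surjOn hs
  exact hinj hts ▸ ht

/-- Two units acting alike on `S` differ by one that centralizes `S`, which `ψ` kills; so the image
embeds in the self-maps of `S`. -/
theorem finite_map_conjStabilizer {R Γ : Type*} [Monoid R] [Group Γ] {S : Set R} (hS : S.Finite)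
    (ψ : Rˣ →* Γ) (hψ : ∀ u : Rˣ, (∀ s ∈ S, (u : R) * s = s * u) → ψ u = 1) :
    Finite ((conjStabilizer S).map ψ) := by
  have := hS.to_subtype
  choose f hf using fun x : (conjStabilizer S).map ψ => x.2
  refine Finite.of_injective (β := S → S)
    (fun x s => ⟨(f x : R) * s * ((f x)⁻¹ : Rˣ), ((hf x).1 s).1 s.2⟩) fun x y hxy => ?_
  refine Subtype.ext ?_
  rw [← (hf x).2, ← (hf y).2, ← inv_mul_eq_one, ← map_inv, ← map_mul]
  refine hψ _ fun s hs => ?_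
  have hs' : (f x : R) * s * ((f x)⁻¹ : Rˣ) = (f y : R) * s * ((f y)⁻¹ : Rˣ) :=
    congrArg Subtype.val (congrFun hxy ⟨s, hs⟩)
  rw [Units.val_mul]
  calc (((f x)⁻¹ : Rˣ) : R) * f y * s
      = ((f x)⁻¹ : Rˣ) * ((f y : R) * s * ((f y)⁻¹ : Rˣ)) * f y := by simp [mul_assoc]
    _ = s * (((f x)⁻¹ : Rˣ) * f y) := by rw [← hs']; simp [mul_assoc]

end

/-! ### The lower bound 2, and the splitting of the quaternions. -/

section

universe u

variable {K : Type u} [Field K]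

theorem two_le_of_isJordanBound {n : ℕ} (hn : IsJordanBound PGL(2, K) n) : 2 ≤ n := by
  let s : GL (Fin 2) K := ⟨!![0, 1; 1, 0], !![0, 1; 1, 0], by simp [one_fin_two],
    by simp [one_fin_two]⟩
  let t : GL (Fin 2) K := ⟨!![-1, -1; 0, 1], !![-1, -1; 0, 1], by simp [one_fin_two],
    by simp [one_fin_two]⟩
  -- The three reflections `s`, `t`, `s * t * s` of a copy of the symmetric group on three letters.
  let S : Set (Matrix (Fin 2) (Fin 2) K) := {!![0, 1; 1, 0], !![-1, -1; 0, 1], !![1, 0; -1, -1]}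
  have hS : S.Finite := Set.toFinite _
  have hs : s ∈ conjStabilizer S := mem_conjStabilizer_of_forall hS <| by
    rintro _ (rfl | rfl | rfl)
    · exact ⟨_, Or.inl rfl, rfl⟩
    · exact ⟨_, Or.inr (Or.inr rfl), by simp [s]⟩
    · exact ⟨_, Or.inr (Or.inl rfl), by simp [s]⟩
  have ht : t ∈ conjStabilizer S := mem_conjStabilizer_of_forall hS <| by
    rintro _ (rfl | rfl | rfl)
    · exact ⟨_, Or.inr (Or.inr rfl), by simp [t]⟩
    · exact ⟨_, Or.inr (Or.inl rfl), rfl⟩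
    · exact ⟨_, Or.inl rfl, by simp [t]⟩
  have hfin : Finite ((conjStabilizer S).map (ProjGenLinGroup.mk (n := Fin 2) (R := K))) :=
    finite_map_conjStabilizer hS _ fun g hg => by
      rw [mk_eq_one_iff_mem_range_scalar, mem_range_scalar_iff]
      have h1 := hg _ (Or.inl rfl)
      have h2 := hg _ (Or.inr (Or.inl rfl))
      have e1 := congrFun (congrFun h1 0) 0
      have e2 := congrFun (congrFun h1 0) 1
      have e3 := congrFun (congrFun h2 0) 0
      simp [mul_apply] at e1 e2 e3
      refine ⟨?_, ?_, e2⟩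
      · rw [e1]; exact e3
      · exact e3
  obtain ⟨A, -, hA, hle⟩ := hn _ hfin
  by_contra! hlt
  have hi : A.index ≠ 0 := Subgroup.index_ne_zero_of_finite
  have htop : A = ⊤ := Subgroup.index_eq_one.1 (by omega)
  have hcomm := congrArg Subtype.val (hA ⟨_, Subgroup.mem_map_of_mem _ hs⟩ (htop ▸ Subgroup.mem_top _)
    ⟨_, Subgroup.mem_map_of_mem _ ht⟩ (htop ▸ Subgroup.mem_top _))
  change ProjGenLinGroup.mk s * ProjGenLinGroup.mk t = ProjGenLinGroup.mk t * ProjGenLinGroup.mk s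
    at hcomm
  rw [← map_mul, ← map_mul, ProjGenLinGroup.mk_eq_mk_iff] at hcomm
  obtain ⟨u, hu⟩ := hcomm
  -- This entry is 0 for `s * t` and -1 for `t * s`, so no scalar relates the two products.
  have := congrArg (fun M : GL (Fin 2) K => M.val 0 0) hu
  simp [s, t, mul_apply] at this

/-- Hamilton's quaternions over a field in which `-1` is a sum of two squares are split. -/
theorem exists_quaternion_algEquiv [CharZero K] {a b : K} (hab : a ^ 2 + b ^ 2 = -1) :
    Nonempty (ℍ[K] ≃ₐ[K] Matrix (Fin 2) (Fin 2) K) := by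
  -- The image of `j` is symmetric and traceless, so it anticommutes with that of `i`, and its
  -- square is the scalar `a ^ 2 + b ^ 2`.
  let B : QuaternionAlgebra.Basis (Matrix (Fin 2) (Fin 2) K) (-1 : K) 0 (-1) :=
    { i := !![0, 1; -1, 0]
      j := !![a, b; b, -a]
      k := !![b, -a; -a, -b]
      i_mul_i := by
        ext i j
        fin_cases i <;> fin_cases j <;> simp
      j_mul_j := by
        ext i j
        fin_cases i <;> fin_cases j <;> simp <;>
          first | linear_combination hab | ring
      i_mul_j := by
        ext i j
        fin_cases i <;> fin_cases j <;> simp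
      j_mul_i := by
        ext i j
        fin_cases i <;> fin_cases j <;> simp }
  let Φ : ℍ[K] →ₐ[K] Matrix (Fin 2) (Fin 2) K := B.liftHom
  have hΦ : Function.Injective Φ := by
    refine (injective_iff_map_eq_zero Φ).2 fun q hq => ?_
    have hq' : B.lift q = 0 := hq
    have h00 := congrFun (congrFun hq' 0) 0
    have h01 := congrFun (congrFun hq' 0) 1
    have h10 := congrFun (congrFun hq' 1) 0
    have h11 := congrFun (congrFun hq' 1) 1
    simp [QuaternionAlgebra.Basis.lift, B, Algebra.algebraMap_eq_smul_one] at h00 h01 h10 h11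
    have hx : q.re = 0 := by linear_combination (h00 + h11) / 2
    have hy : q.imI = 0 := by linear_combination (h01 - h10) / 2
    have hz : q.imJ = 0 := by
      linear_combination q.imJ * hab - a * (h00 - h11) / 2 - b * (h01 + h10) / 2
    have hw : q.imK = 0 := by
      linear_combination q.imK * hab - b * (h00 - h11) / 2 + a * (h01 + h10) / 2
    exact Quaternion.ext _ _ hx hy hz hw
  refine ⟨AlgEquiv.ofBijective Φ ⟨hΦ, ?_⟩⟩
  refine (LinearMap.injective_iff_surjective_of_finrank_eq_finrank (f := Φ.toLinearMap) ?_).1 hΦ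
  rw [Quaternion.finrank_eq_four, Module.finrank_matrix]
  simp

end

/-! ### Octahedral and icosahedral groups from quaternions; the lower bounds 6 and 60. -/

section

universe u

variable {K : Type u} [Field K]

/-- The quaternion with the given coordinates. -/
def quat (a b c d : K) : ℍ[K] := ⟨a, b, c, d⟩

@[simp] theorem quat_re (a b c d : K) : (quat a b c d).re = a := rfl

@[simp] theorem quat_imI (a b c d : K) : (quat a b c d).imI = b := rfl

@[simp] theorem quat_imJ (a b c d : K) : (quat a b c d).imJ = c := rfl

@[simp] theorem quat_imK (a b c d : K) : (quat a b c d).imK = d := rfl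

/-- The projective representation of the unit group of a split quaternion algebra. -/
def quaternionToPGL (Φ : ℍ[K] ≃ₐ[K] Matrix (Fin 2) (Fin 2) K) : ℍ[K]ˣ →* PGL(2, K) :=
  ProjGenLinGroup.mk.comp (Units.map Φ.toRingEquiv.toRingHom.toMonoidHom)

variable (Φ : ℍ[K] ≃ₐ[K] Matrix (Fin 2) (Fin 2) K)

theorem quaternionToPGL_eq_one_iff {u : ℍ[K]ˣ} : quaternionToPGL Φ u = 1 ↔
    u.val.imI = 0 ∧ u.val.imJ = 0 ∧ u.val.imK = 0 := by
  have h : quaternionToPGL Φ u = 1 ↔ Φ u.val ∈ Set.range (scalar (Fin 2)) :=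
    mk_eq_one_iff_mem_range_scalar
  have hc (c : K) : Φ (algebraMap K ℍ[K] c) = scalar (Fin 2) c := by
    rw [AlgEquiv.commutes]
    rfl
  rw [h]
  constructor
  · rintro ⟨c, h⟩
    rw [← hc] at h
    rw [← Φ.injective h]
    simp [Quaternion.algebraMap_def]
  · rintro ⟨h1, h2, h3⟩
    refine ⟨u.val.re, ?_⟩
    rw [← hc]
    congr 1
    ext <;> simp [Quaternion.algebraMap_def, *]

theorem quaternionToPGL_mul_comm {u v : ℍ[K]ˣ}
    (h : quaternionToPGL Φ u * quaternionToPGL Φ v = quaternionToPGL Φ v * quaternionToPGL Φ u) :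
    ∃ c : K, u.val * v.val = c • (v.val * u.val) := by
  have h1 : quaternionToPGL Φ (u * v * (v * u)⁻¹) = 1 := by
    rw [map_mul, map_inv, map_mul, map_mul, h, mul_inv_cancel]
  rw [quaternionToPGL_eq_one_iff] at h1
  set w := u * v * (v * u)⁻¹ with hw
  have h2 : (w : ℍ[K]) = algebraMap K ℍ[K] w.val.re := by
    ext <;> simp [Quaternion.algebraMap_def, h1]
  refine ⟨w.val.re, ?_⟩
  rw [Algebra.smul_def, ← h2, ← Units.val_mul, ← Units.val_mul, ← Units.val_mul, hw,
    inv_mul_cancel_right]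

theorem isUnit_quaternion {q : ℍ[K]} (h : q.re ^ 2 + q.imI ^ 2 + q.imJ ^ 2 + q.imK ^ 2 ≠ 0) :
    IsUnit q := by
  rw [← Quaternion.normSq_def'] at h
  refine ⟨⟨q, (Quaternion.normSq q)⁻¹ • star q, ?_, ?_⟩, rfl⟩
  · rw [mul_smul_comm, Quaternion.self_mul_star, ← Quaternion.coe_smul, smul_eq_mul,
      inv_mul_cancel₀ h, Quaternion.coe_one]
  · rw [smul_mul_assoc, Quaternion.star_mul_self, ← Quaternion.coe_smul, smul_eq_mul,
      inv_mul_cancel₀ h, Quaternion.coe_one]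

/-- The vectors `±f i`. -/
def signedRange {n : ℕ} (f : Fin n → ℍ[K]) : Set ℍ[K] := {q | ∃ i, q = f i ∨ q = -f i}

theorem finite_signedRange {n : ℕ} (f : Fin n → ℍ[K]) : (signedRange f).Finite := by
  refine ((Set.finite_range f).union (Set.finite_range fun i => -f i)).subset ?_
  rintro q ⟨i, rfl | rfl⟩
  · exact Or.inl ⟨i, rfl⟩
  · exact Or.inr ⟨i, rfl⟩

theorem mem_conjStabilizer_signedRange {n : ℕ} {f : Fin n → ℍ[K]} {u : ℍ[K]ˣ}
    (h : ∀ i, ∃ j, u.val * f i = f j * u.val ∨ u.val * f i = -(f j * u.val)) :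
    u ∈ conjStabilizer (signedRange f) := by
  refine mem_conjStabilizer_of_forall (finite_signedRange f) ?_
  rintro q ⟨i, hq⟩
  obtain ⟨j, hj⟩ := h i
  rcases hq with rfl | rfl <;> rcases hj with hj | hj
  · exact ⟨f j, ⟨j, Or.inl rfl⟩, hj⟩
  · exact ⟨-f j, ⟨j, Or.inr rfl⟩, by rw [hj, neg_mul]⟩
  · exact ⟨-f j, ⟨j, Or.inr rfl⟩, by rw [mul_neg, hj, neg_mul]⟩
  · exact ⟨f j, ⟨j, Or.inl rfl⟩, by rw [mul_neg, hj, neg_neg]⟩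

/-- If a finite symmetric set of vectors spanning the imaginary quaternions is preserved by the
rotations `1 + i + j + k` and `1 + i - j - k` and by a further element of order `m > 3`, the group
of its rotations is polyhedral of type `m`. -/
theorem exists_polyhedral_subgroup [CharZero K] {n : ℕ} {f : Fin n → ℍ[K]} {u : ℍ[K]}
    (hu : IsUnit u)
    (hf : ∀ q : ℍ[K], (∀ i, q * f i = f i * q) → q.imI = 0 ∧ q.imJ = 0 ∧ q.imK = 0)
    (h₁ : ∀ i, ∃ j, quat 1 1 1 1 * f i = f j * quat 1 1 1 1 ∨
      quat 1 1 1 1 * f i = -(f j * quat 1 1 1 1))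
    (h₂ : ∀ i, ∃ j, quat 1 1 (-1) (-1) * f i = f j * quat 1 1 (-1) (-1) ∨
      quat 1 1 (-1) (-1) * f i = -(f j * quat 1 1 (-1) (-1)))
    (h₃ : ∀ i, ∃ j, u * f i = f j * u ∨ u * f i = -(f j * u))
    (hord : 3 < orderOf (quaternionToPGL Φ hu.unit)) :
    ∃ (G : Subgroup PGL(2, K)) (_ : Finite G) (P : Type u) (_ : MulAction G P),
      IsPolarAction G P ∧ IsPolyhedral G P (orderOf (quaternionToPGL Φ hu.unit)) := by
  obtain ⟨v, hv⟩ : IsUnit (quat (K := K) 1 1 1 1) := isUnit_quaternion (by norm_num)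
  obtain ⟨w, hw⟩ : IsUnit (quat (K := K) 1 1 (-1) (-1)) := isUnit_quaternion (by norm_num)
  have hfin : Finite ((conjStabilizer (signedRange f)).map (quaternionToPGL Φ)) :=
    finite_map_conjStabilizer (finite_signedRange f) _ fun q hq => by
      rw [quaternionToPGL_eq_one_iff]
      exact hf _ fun i => hq _ ⟨i, Or.inl rfl⟩
  refine ⟨_, hfin, exists_isPolyhedral_orderOf (b := quaternionToPGL Φ v)
    (c := quaternionToPGL Φ w) (g := quaternionToPGL Φ hu.unit)
    (Subgroup.mem_map_of_mem _ (mem_conjStabilizer_signedRange (by rwa [hv]))) ?_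
    (Subgroup.mem_map_of_mem _ (mem_conjStabilizer_signedRange (by rwa [hw]))) ?_ ?_
    (Subgroup.mem_map_of_mem _ (mem_conjStabilizer_signedRange h₃)) hord⟩
  · rw [← map_pow, quaternionToPGL_eq_one_iff, Units.val_pow_eq_pow_val, hv, pow_succ, sq]
    simp
  · rw [← map_pow, quaternionToPGL_eq_one_iff, Units.val_pow_eq_pow_val, hw, pow_succ, sq]
    simp
  · intro hcomm
    obtain ⟨c, hc⟩ := quaternionToPGL_mul_comm Φ hcomm
    rw [hv, hw] at hc
    -- The two products have the same nonzero real part, forcing `c = 1`, but opposite nonzero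
    -- j-components.
    have e1 := congrArg QuaternionAlgebra.re hc
    have e2 := congrArg QuaternionAlgebra.imJ hc
    simp at e1 e2
    grind

theorem six_le_of_isJordanBound [CharZero K] {a b : K} (hab : a ^ 2 + b ^ 2 = -1) {n : ℕ}
    (hn : IsJordanBound PGL(2, K) n) : 6 ≤ n := by
  obtain ⟨Φ⟩ := exists_quaternion_algEquiv hab
  -- 1 + i is the quarter turn about the first axis; the set `f` below consists of the three
  -- coordinate axes, through the vertices of an octahedron.
  have hu : IsUnit (quat (K := K) 1 1 0 0) := isUnit_quaternion (by norm_num)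
  have hord : orderOf (quaternionToPGL Φ hu.unit) = 4 := by
    refine orderOf_eq_prime_pow (p := 2) (n := 1) ?_ ?_
    · rw [← map_pow, quaternionToPGL_eq_one_iff, Units.val_pow_eq_pow_val, IsUnit.unit_spec,
        pow_one, sq]
      simp
    · rw [← map_pow, quaternionToPGL_eq_one_iff, Units.val_pow_eq_pow_val, IsUnit.unit_spec,
        show 2 ^ (1 + 1) = 2 * 2 by norm_num, pow_mul, sq, sq]
      simp
  obtain ⟨G, hfin, P, _, h, hm⟩ := exists_polyhedral_subgroup Φ hu
    (f := ![quat 0 1 0 0, quat 0 0 1 0, quat 0 0 0 1])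
    (fun q hq => by
      have e1 := congrArg QuaternionAlgebra.imJ (hq 0)
      have e2 := congrArg QuaternionAlgebra.imK (hq 0)
      have e3 := congrArg QuaternionAlgebra.imK (hq 1)
      simp at e1 e2 e3
      grind)
    (fun i => by
      fin_cases i
      · exact ⟨1, Or.inl (by ext <;> simp)⟩
      · exact ⟨2, Or.inl (by ext <;> simp)⟩
      · exact ⟨0, Or.inl (by ext <;> simp)⟩)
    (fun i => by
      fin_cases i
      · exact ⟨1, Or.inr (by ext <;> simp)⟩
      · exact ⟨2, Or.inl (by ext <;> simp)⟩
      · exact ⟨0, Or.inr (by ext <;> simp)⟩)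
    (fun i => by
      fin_cases i
      · exact ⟨0, Or.inl (by ext <;> simp)⟩
      · exact ⟨2, Or.inl (by ext <;> simp)⟩
      · exact ⟨1, Or.inr (by ext <;> simp)⟩)
    (by omega)
  obtain ⟨A, hA, hcomm, hle⟩ := hn G hfin
  exact (hm.six_le_index h hord hA hcomm).trans hle

theorem sixty_le_of_isJordanBound [CharZero K] {a b c : K} (hab : a ^ 2 + b ^ 2 = -1)
    (hc : c ^ 2 = 5) {n : ℕ} (hn : IsJordanBound PGL(2, K) n) : 60 ≤ n := by
  obtain ⟨Φ⟩ := exists_quaternion_algEquiv hab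
  obtain ⟨t, ht⟩ : ∃ t : K, t ^ 2 = t + 1 := ⟨(1 + c) / 2, by linear_combination hc / 4⟩
  -- Since `t * (t - 1) = 1`, the axis (t - 1, 1, 0) is proportional to the icosahedron vertex (1,
  -- t, 0). The norm is 4, so the half-angle has cosine t/2, that of a rotation of order 5. The list
  -- `f` below gives the six vertex axes.
  have hu : IsUnit (quat (K := K) t (t - 1) 1 0) := isUnit_quaternion (by
    have : t ^ 2 + (t - 1) ^ 2 + 1 ^ 2 + 0 ^ 2 = 4 := by linear_combination 2 * ht
    exact this.trans_ne (by norm_num : (4 : K) ≠ 0))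
  have hord : orderOf (quaternionToPGL Φ hu.unit) = 5 := by
    have : Fact (Nat.Prime 5) := ⟨by norm_num⟩
    refine orderOf_eq_prime ?_ ?_
    · rw [← map_pow, quaternionToPGL_eq_one_iff, Units.val_pow_eq_pow_val, IsUnit.unit_spec]
      have h2 : (quat t (t - 1) 1 0) ^ 2 = quat (2 * t - 2) 2 (2 * t) 0 := by
        rw [sq]
        ext <;> simp <;> grind
      rw [show 5 = 2 * 2 + 1 by norm_num, pow_succ, pow_mul, h2, sq]
      simp
      grind
    · rw [Ne, quaternionToPGL_eq_one_iff, IsUnit.unit_spec]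
      simp
  obtain ⟨G, hfin, P, _, h, hm⟩ := exists_polyhedral_subgroup Φ hu
    (f := ![quat 0 1 t 0, quat 0 (-1) t 0, quat 0 0 1 t, quat 0 0 (-1) t, quat 0 t 0 1,
      quat 0 t 0 (-1)])
    (fun q hq => by
      have e1 := congrArg QuaternionAlgebra.imK (hq 0)
      have e2 := congrArg QuaternionAlgebra.imK (hq 1)
      have e3 := congrArg QuaternionAlgebra.imI (hq 2)
      have e4 := congrArg QuaternionAlgebra.imI (hq 3)
      simp at e1 e2 e3 e4
      grind)
    (fun i => by
      fin_cases i
      · exact ⟨2, Or.inl (by ext <;> simp <;> ring)⟩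
      · exact ⟨3, Or.inl (by ext <;> simp <;> ring)⟩
      · exact ⟨4, Or.inl (by ext <;> simp <;> ring)⟩
      · exact ⟨5, Or.inl (by ext <;> simp <;> ring)⟩
      · exact ⟨0, Or.inl (by ext <;> simp <;> ring)⟩
      · exact ⟨1, Or.inl (by ext <;> simp <;> ring)⟩)
    (fun i => by
      fin_cases i
      · exact ⟨3, Or.inl (by ext <;> simp <;> ring)⟩
      · exact ⟨2, Or.inl (by ext <;> simp <;> ring)⟩
      · exact ⟨5, Or.inr (by ext <;> simp <;> ring)⟩
      · exact ⟨4, Or.inr (by ext <;> simp <;> ring)⟩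
      · exact ⟨0, Or.inr (by ext <;> simp <;> ring)⟩
      · exact ⟨1, Or.inr (by ext <;> simp <;> ring)⟩)
    (fun i => by
      fin_cases i
      · exact ⟨0, Or.inl (by ext <;> simp <;> grind)⟩
      · exact ⟨2, Or.inl (by ext <;> simp <;> grind)⟩
      · exact ⟨4, Or.inl (by ext <;> simp <;> grind)⟩
      · exact ⟨1, Or.inr (by ext <;> simp <;> grind)⟩
      · exact ⟨5, Or.inl (by ext <;> simp <;> grind)⟩
      · exact ⟨3, Or.inr (by ext <;> simp <;> grind)⟩)
    (by omega)
  obtain ⟨A, hA, hcomm, hle⟩ := hn G hfin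
  exact (hm.sixty_le_index h hord hA hcomm).trans hle

end

theorem proposition1p5 (K : Type*) [Field K] [CharZero K] :
    (IsJordanConstant PGL(2, K) 60 ∨ IsJordanConstant PGL(2, K) 6 ∨
      IsJordanConstant PGL(2, K) 2) ∧
    (IsJordanConstant PGL(2, K) 60 ↔
      (∃ a b : K, a ^ 2 + b ^ 2 = -1) ∧ ∃ c : K, c ^ 2 = 5) ∧
    (IsJordanConstant PGL(2, K) 6 ↔
      (∃ a b : K, a ^ 2 + b ^ 2 = -1) ∧ ¬ ∃ c : K, c ^ 2 = 5) ∧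
    (IsJordanConstant PGL(2, K) 2 ↔
      ¬ ∃ a b : K, a ^ 2 + b ^ 2 = -1) := by
  have hunique {m n : ℕ} (hm : IsJordanConstant PGL(2, K) m) (hn : IsJordanConstant PGL(2, K) n) :
      m = n := IsLeast.unique hm hn
  by_cases h1 : ∃ a b : K, a ^ 2 + b ^ 2 = -1
  · have ⟨a, b, hab⟩ := h1
    by_cases h5 : ∃ c : K, c ^ 2 = 5
    · have ⟨c, hc⟩ := h5
      have h : IsJordanConstant PGL(2, K) 60 :=
        ⟨isJordanBound_sixty, fun _ hn => sixty_le_of_isJordanBound hab hc hn⟩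
      have h6 : ¬ IsJordanConstant PGL(2, K) 6 := fun h' => by have := hunique h h'; omega
      have h2 : ¬ IsJordanConstant PGL(2, K) 2 := fun h' => by have := hunique h h'; omega
      exact ⟨Or.inl h, iff_of_true h ⟨h1, h5⟩, iff_of_false h6 fun x => x.2 h5,
        iff_of_false h2 fun x => x h1⟩
    · have h : IsJordanConstant PGL(2, K) 6 :=
        ⟨isJordanBound_six h5, fun _ hn => six_le_of_isJordanBound hab hn⟩
      have h60 : ¬ IsJordanConstant PGL(2, K) 60 := fun h' => by have := hunique h h'; omega
      have h2 : ¬ IsJordanConstant PGL(2, K) 2 := fun h' => by have := hunique h h'; omega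
      exact ⟨Or.inr (Or.inl h), iff_of_false h60 fun x => h5 x.2, iff_of_true h ⟨h1, h5⟩,
        iff_of_false h2 fun x => x h1⟩
  · have h : IsJordanConstant PGL(2, K) 2 :=
      ⟨isJordanBound_two h1, fun _ hn => two_le_of_isJordanBound hn⟩
    have h60 : ¬ IsJordanConstant PGL(2, K) 60 := fun h' => by have := hunique h h'; omega
    have h6 : ¬ IsJordanConstant PGL(2, K) 6 := fun h' => by have := hunique h h'; omega
    exact ⟨Or.inr (Or.inr h), iff_of_false h60 fun x => h1 x.1, iff_of_false h6 fun x => h1 x.1,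
      iff_of_true h h1⟩
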